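/- \textbf{Theorem (Annealed CLT for $\mathrm{CM}_N(\mathbf 2)$).} For a finite multigraph $G$ with vertex set $[N]=\{1,\dots,N\}$ and a spin configuration $\sigma\in\Omega_N=\{-1,1\}^N$, let $S_N(\sigma)=\sum_{i\in[N]}\sigma_i$ and $$w_{G}(\sigma)=\exp\Big[\beta\sum_{\{i,j\}\in E(G)}\sigma_i\sigma_j+B\,S_N(\sigma)\Big],\qquad Z_{G}(\beta,B)=\sum_{\sigma\in\Omega_N}w_{G}(\sigma),$$ where the edges in $E(G)$, including self-loops, are counted with multiplicity. The Boltzmann--Gibbs measure on $G$ is $\mu_G(\sigma)=w_G(\sigma)/Z_G(\beta,B)$, and the susceptibility of the Ising model on $G$ is $$\chi_G(\beta,B)=\frac{\partial}{\partial B}\,\mu_G\Big(\frac{S_N}{N}\Big).$$ Let $(G_N)_{N\ge1}$ be a sequence of random multigraphs, defined on a common probability space (with an arbitrary joint law), such that $G_N$ is a 2-regular configuration model $\mathrm{CM}_N(\mathbf 2)$: two half-edges are attached to each vertex of $[N]$, the $2N$ half-edges are paired uniformly at random, and each pair forms an edge. Let $Q_N$ denote expectation with respect to the law of $G_N$, and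 let $\widetilde P_N$ be the annealed measure on $\Omega_N$, $$\widetilde P_N(\sigma)=\frac{Q_N\big(w_{G_N}(\sigma)\big)}{Q_N\big(Z_{G_N}(\beta,B)\big)}.$$ Then for all $\beta\ge0$ and $B\in\mathbb R$ there is a number $\chi=\chi(\beta,B)\ge 0$ such that the following hold. (i) The total spin satisfies the central limit theorem $$\frac{S_N-\widetilde P_N(S_N)}{\sqrt N}\ \xrightarrow{\ \mathcal D\ }\ \mathcal N(0,\chi)\qquad\text{w.r.t. }\widetilde P_N,\ \text{as }N\to\infty,$$ where $\mathcal N(0,\chi)$ is the centered normal law with variance $\chi$. (ii) $\chi$ is the thermodynamic limit of the (random) quenched susceptibility: almost surely, $\chi_{G_N}(\beta,B)\to\chi$ as $N\to\infty$. (iii) $\chi$ is the susceptibility of the one-dimensional Ising model: $\chi_{C_N}(\beta,B)\to\chi$ as $N\to\infty$, where $C_N$ is the cycle with $N$ vertices (periodic boundary conditions). Explicitly, $$\chi(\beta,B)=\chi^{d=1}(\beta,B)=\frac{\cosh(B)\,e^{-4\beta}}{\big(\sinh^2(B)+e^{-4\beta}\big)^{3/2}}.$$ -/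

import Mathlib

open MeasureTheory ProbabilityTheory Filter
open scoped Topology NNReal ENNReal

noncomputable section

/-! ### Multigraphs and the configuration model -/

/-- A finite undirected multigraph on the vertex set `V`: a multiset of unordered pairs of
vertices, so that self-loops and multiple edges are allowed. -/
structure Multigraph (V : Type) where
  edges : Multiset (Sym2 V)

instance (V : Type) : MeasurableSpace (Multigraph V) := ⊤

/-- The half-edges attached to the vertices `0, …, N - 1`, with `d i` of them at vertex `i`. -/
abbrev HalfEdge {N : ℕ} (d : Fin N → ℕ) : Type := Σ i : Fin N, Fin (d i)

/-- A pairing of the half-edges (a perfect matching): a fixed-point free involution. -/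
def Pairing {N : ℕ} (d : Fin N → ℕ) : Type :=
  {π : Equiv.Perm (HalfEdge d) // ∀ h, π h ≠ h ∧ π (π h) = h}

instance {N : ℕ} (d : Fin N → ℕ) : Finite (Pairing d) :=
  inferInstanceAs (Finite {π : Equiv.Perm (HalfEdge d) // ∀ h, π h ≠ h ∧ π (π h) = h})

instance {N : ℕ} (d : Fin N → ℕ) : MeasurableSpace (Pairing d) := ⊤

instance {N : ℕ} (d : Fin N → ℕ) : MeasurableSingletonClass (Pairing d) := ⟨fun _ => trivial⟩

instance {N : ℕ} : Nonempty (Pairing (fun _ : Fin N => 2)) :=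
  ⟨⟨Equiv.sigmaCongrRight fun _ => Equiv.swap 0 1, by
    rintro ⟨i, k⟩
    fin_cases k <;> simp⟩⟩

/-- The multigraph produced by a pairing. The pairs `{h, π h}` of half-edges are collected in a
finset (each pair once), and every such pair becomes one edge between the vertices that carry
the two half-edges. -/
def Pairing.toMultigraph {N : ℕ} {d : Fin N → ℕ} (π : Pairing d) : Multigraph (Fin N) :=
  ⟨((Finset.univ.image fun h : HalfEdge d => s(h, π.1 h)).val).map (Sym2.map Sigma.fst)⟩

/-- The law of the configuration model with degree sequence `d`: the half-edges are paired
uniformly at random. -/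
def configurationModel {N : ℕ} (d : Fin N → ℕ) : Measure (Multigraph (Fin N)) :=
  (uniformOn (Set.univ : Set (Pairing d))).map Pairing.toMultigraph

/-- The law of the 2-regular configuration model on `N` vertices. -/
def twoRegularCM (N : ℕ) : Measure (Multigraph (Fin N)) :=
  configurationModel (fun _ : Fin N => 2)

instance (N : ℕ) : IsProbabilityMeasure (twoRegularCM N) :=
  have : IsProbabilityMeasure (uniformOn (Set.univ : Set (Pairing fun _ : Fin N => 2))) :=
    isProbabilityMeasure_uniformOn Set.finite_univ Set.univ_nonempty
  Measure.isProbabilityMeasure_map (measurable_from_top).aemeasurable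

/-! ### The Ising model on a multigraph -/

/-- Spin configurations on `N` vertices; `ℤˣ = {1, -1}`. -/
abbrev SpinConfig (N : ℕ) : Type := Fin N → ℤˣ

/-- The value `±1` of the spin at vertex `i` as a real number. -/
def spin {N : ℕ} (σ : SpinConfig N) (i : Fin N) : ℝ := ((σ i : ℤ) : ℝ)

/-- The total spin. -/
def totalSpin {N : ℕ} (σ : SpinConfig N) : ℝ := ∑ i, spin σ i

/-- The sum, over the edges `{i, j}` with multiplicity, of the products of the end spins. -/
def edgeSum {N : ℕ} (G : Multigraph (Fin N)) (σ : SpinConfig N) : ℝ :=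
  (G.edges.map
    (Sym2.lift ⟨fun i j => spin σ i * spin σ j, fun _ _ => mul_comm _ _⟩)).sum

/-- The Boltzmann weight at inverse temperature `β` and external field `B`. -/
def boltzmannWeight {N : ℕ} (G : Multigraph (Fin N)) (β B : ℝ) (σ : SpinConfig N) : ℝ :=
  Real.exp (β * edgeSum G σ + B * totalSpin σ)

/-- The partition function. -/
def partitionFunction {N : ℕ} (G : Multigraph (Fin N)) (β B : ℝ) : ℝ :=
  ∑ σ, boltzmannWeight G β B σ

/-- The magnetization per vertex: the mean of the total spin divided by `N` under the
Boltzmann-Gibbs measure of the (fixed) multigraph `G`. -/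
def magnetization {N : ℕ} (G : Multigraph (Fin N)) (β B : ℝ) : ℝ :=
  (∑ σ, boltzmannWeight G β B σ / partitionFunction G β B * totalSpin σ) / N

/-- The finite-volume (quenched) susceptibility of the multigraph `G`: the derivative of the
magnetization with respect to the external field. -/
def susceptibility {N : ℕ} (G : Multigraph (Fin N)) (β B : ℝ) : ℝ :=
  deriv (fun b => magnetization G β b) B

/-- The cycle with `N` vertices, that is, the one-dimensional lattice with periodic boundary
conditions (a self-loop for `N = 1`, a double edge for `N = 2`). -/
def cycle (N : ℕ) : Multigraph (Fin N) :=
  ⟨Finset.univ.val.map fun i : Fin N => s(i, finRotate N i)⟩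

/-! ### The annealed measure -/

/-- The annealed probability of a spin configuration, for the random graph law `Q`: numerator
and denominator of the Boltzmann-Gibbs distribution are averaged separately. -/
def annealedProb {N : ℕ} (Q : Measure (Multigraph (Fin N))) (β B : ℝ) (σ : SpinConfig N) : ℝ :=
  (∫ G, boltzmannWeight G β B σ ∂Q) / ∫ G, partitionFunction G β B ∂Q

/-- The annealed measure on spin configurations. -/
def annealedMeasure {N : ℕ} (Q : Measure (Multigraph (Fin N))) (β B : ℝ) :
    Measure (SpinConfig N) :=
  ∑ σ, ENNReal.ofReal (annealedProb Q β B σ) • Measure.dirac σ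

lemma boltzmannWeight_pos {N : ℕ} (G : Multigraph (Fin N)) (β B : ℝ) (σ : SpinConfig N) :
    0 < boltzmannWeight G β B σ := Real.exp_pos _

lemma integrable_twoRegularCM {N : ℕ} (f : Multigraph (Fin N) → ℝ) :
    Integrable f (twoRegularCM N) := by
  have : IsProbabilityMeasure (uniformOn (Set.univ : Set (Pairing fun _ : Fin N => 2))) :=
    isProbabilityMeasure_uniformOn Set.finite_univ Set.univ_nonempty
  refine (integrable_map_measure measurable_from_top.aestronglyMeasurable
    measurable_from_top.aemeasurable).2 Integrable.of_finite

instance (N : ℕ) (β B : ℝ) : IsProbabilityMeasure (annealedMeasure (twoRegularCM N) β B) := by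
  have hZ : ∫ G, partitionFunction G β B ∂(twoRegularCM N)
      = ∑ σ, ∫ G, boltzmannWeight G β B σ ∂(twoRegularCM N) :=
    integral_finsetSum _ fun σ _ => integrable_twoRegularCM _
  have hpos : 0 < ∫ G, partitionFunction G β B ∂(twoRegularCM N) := by
    have hp : ∀ G : Multigraph (Fin N), 0 < partitionFunction G β B := fun G =>
      Finset.sum_pos (fun σ _ => boltzmannWeight_pos G β B σ) Finset.univ_nonempty
    rw [integral_pos_iff_support_of_nonneg (fun G => (hp G).le) (integrable_twoRegularCM _)]
    have : Function.support (fun G : Multigraph (Fin N) => partitionFunction G β B)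
        = Set.univ := Set.eq_univ_of_forall fun G => (hp G).ne'
    rw [this]
    simp
  have hnn : ∀ σ : SpinConfig N, 0 ≤ annealedProb (twoRegularCM N) β B σ := fun σ =>
    div_nonneg (integral_nonneg fun G => (boltzmannWeight_pos G β B σ).le) hpos.le
  refine ⟨?_⟩
  simp only [annealedMeasure, Measure.coe_finsetSum, Finset.sum_apply, Measure.smul_apply,
    measure_univ, smul_eq_mul, mul_one]
  rw [← ENNReal.ofReal_sum_of_nonneg fun σ _ => hnn σ]
  simp only [annealedProb]
  rw [← Finset.sum_div, ← hZ, div_self hpos.ne', ENNReal.ofReal_one]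

end

/-!
Diagonalising the transfer matrix of the one-dimensional Ising model shows that a 2-regular
multigraph with cycle lengths `L₁, …, Lₘ` has partition function `∏ᵢ (Λ₊ ^ Lᵢ + Λ₋ ^ Lᵢ)`, where
`Λ₊` and `Λ₋` are the eigenvalues. With `r = Λ₋ / Λ₊`, which satisfies `|r| < 1`, this is
`Λ₊ ^ N * ∏ᵢ (1 + r ^ Lᵢ)`.

*Annealed.* Expanding the product chooses a union of cycles, that is, a set of vertices whose
half-edges are paired among themselves. Counting pairings, the mean of `∏ᵢ (1 + r ^ Lᵢ)` is
a polynomial in `r` with bounded coefficients, which converges to the positive power series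
`(1 - r) ^ (-1 / 2)`. Hence the cumulant generating function of `S_N` is `N` times the increment
of `log Λ₊`, up to a correction that vanishes on the scale `√N`. A second order expansion and
the theorem of Curtiss give the Gaussian limit, whose variance `χ` is the second derivative of
`log Λ₊` in the external field.

*Quenched.* The susceptibility is `χ` plus `1 / N` times a sum of corrections, one for each cycle
and bounded uniformly in its length. The case `r = 1` of the expansion bounds the mean of
`2 ^ m` by `N + 1`, so that almost surely `m = o(N)` by the Borel-Cantelli lemma.
-/

noncomputable section

/-! ### Convergence of moment generating functions -/

lemma measure_lt_norm_le_exp_mul_mgf (μ : Measure ℝ) [IsFiniteMeasure μ]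
    (hexp : ∀ t : ℝ, Integrable (fun x => Real.exp (t * x)) μ) (r : ℝ) :
    μ {x | r < ‖x‖} ≤ ENNReal.ofReal (Real.exp (-r) * (mgf id μ 1 + mgf id μ (-1))) := by
  have hcover : {x : ℝ | r < ‖x‖} ⊆ {x | r ≤ id x} ∪ {x | id x ≤ -r} := fun x hx => by
    rcases lt_abs.1 (show r < |x| from hx) with h | h
    · exact Or.inl h.le
    · exact Or.inr (by simpa using (lt_neg.1 h).le)
  have hright := measure_ge_le_exp_mul_mgf (X := id) r zero_le_one (hexp 1)
  have hleft := measure_le_le_exp_mul_mgf (X := id) (-r) (t := -1) (by norm_num) (hexp (-1))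
  rw [← ofReal_measureReal]
  gcongr
  calc μ.real {x | r < ‖x‖} ≤ μ.real {x | r ≤ id x} + μ.real {x | id x ≤ -r} :=
        (measureReal_mono hcover).trans (measureReal_union_le _ _)
    _ ≤ Real.exp (-r) * (mgf id μ 1 + mgf id μ (-1)) := by
        rw [mul_add]
        exact add_le_add (by simpa using hright) (by simpa using hleft)

lemma isTightMeasureSet_range_of_mgf_le {ι : Type*} {μ : ι → Measure ℝ}
    [∀ i, IsFiniteMeasure (μ i)]
    (hexp : ∀ i, ∀ t : ℝ, Integrable (fun x => Real.exp (t * x)) (μ i)) {C : ℝ}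
    (hpos : ∀ i, mgf id (μ i) 1 ≤ C) (hneg : ∀ i, mgf id (μ i) (-1) ≤ C) :
    IsTightMeasureSet (Set.range μ) := by
  refine isTightMeasureSet_of_tendsto_measure_norm_gt ?_
  have hlim : Tendsto (fun r : ℝ => ENNReal.ofReal (Real.exp (-r) * (C + C))) atTop (𝓝 0) := by
    simpa using ENNReal.tendsto_ofReal (Real.tendsto_exp_neg_atTop_nhds_zero.mul_const (C + C))
  refine tendsto_of_tendsto_of_tendsto_of_le_of_le tendsto_const_nhds hlim (fun _ => zero_le) ?_
  refine fun r => iSup₂_le ?_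
  rintro _ ⟨i, rfl⟩
  refine (measure_lt_norm_le_exp_mul_mgf (μ i) (hexp i) r).trans ?_
  exact ENNReal.ofReal_le_ofReal
    (mul_le_mul_of_nonneg_left (add_le_add (hpos i) (hneg i)) (Real.exp_pos _).le)

/-- The moment generating kernel `x ↦ e^{tx}` truncated at height `K`, as a bounded continuous
function; it tests weak convergence. -/
def truncatedExp (t : ℝ) (K : ℕ) : BoundedContinuousFunction ℝ ℝ :=
  .ofNormedAddCommGroup (fun x => min (Real.exp (t * x)) K) (by fun_prop) K fun x => by
    rw [Real.norm_of_nonneg (by positivity)]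
    exact min_le_right _ _

lemma truncatedExp_apply (t : ℝ) (K : ℕ) (x : ℝ) :
    truncatedExp t K x = min (Real.exp (t * x)) K := rfl

lemma exp_sub_truncatedExp_le (t : ℝ) {K : ℕ} (hK : 0 < K) (x : ℝ) :
    Real.exp (t * x) - truncatedExp t K x ≤ Real.exp (2 * t * x) / K := by
  have hK' : (0 : ℝ) < K := by exact_mod_cast hK
  have hsq : Real.exp (2 * t * x) = Real.exp (t * x) * Real.exp (t * x) := by
    rw [← Real.exp_add]; ring_nf
  rw [truncatedExp_apply, hsq, le_div_iff₀ hK']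
  rcases min_cases (Real.exp (t * x)) K with ⟨h, _⟩ | ⟨h, h'⟩ <;> rw [h]
  · simpa using (mul_pos (Real.exp_pos _) (Real.exp_pos _)).le
  · nlinarith [Real.exp_pos (t * x)]

lemma abs_mgf_sub_integral_truncatedExp_le {μ : Measure ℝ} [IsFiniteMeasure μ]
    (hexp : ∀ t : ℝ, Integrable (fun x => Real.exp (t * x)) μ) (t : ℝ) {K : ℕ} (hK : 0 < K) :
    |mgf id μ t - ∫ x, truncatedExp t K x ∂μ| ≤ mgf id μ (2 * t) / K := by
  have htrunc := (truncatedExp t K).integrable μ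
  simp only [mgf, id_eq]
  rw [← integral_sub (hexp t) htrunc, ← integral_div, abs_of_nonneg]
  · exact integral_mono ((hexp t).sub htrunc) ((hexp (2 * t)).div_const _)
      (exp_sub_truncatedExp_le t hK)
  · exact integral_nonneg fun x => sub_nonneg.2 (min_le_left _ _)

lemma mgf_eq_of_tendsto_integral_truncatedExp {μ : Measure ℝ} [IsFiniteMeasure μ] {t m : ℝ}
    (hm : Tendsto (fun K : ℕ => ∫ x, truncatedExp t K x ∂μ) atTop (𝓝 m)) :
    mgf id μ t = m := by
  have hnonneg (K : ℕ) (x : ℝ) : 0 ≤ truncatedExp t K x :=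
    le_min (Real.exp_pos _).le K.cast_nonneg
  have hm0 : 0 ≤ m := ge_of_tendsto' hm fun K => integral_nonneg (hnonneg K)
  have hmono : Tendsto (fun K : ℕ => ∫⁻ x, ENNReal.ofReal (truncatedExp t K x) ∂μ) atTop
      (𝓝 (∫⁻ x, ENNReal.ofReal (Real.exp (t * x)) ∂μ)) := by
    refine lintegral_tendsto_of_tendsto_of_monotone
      (fun K => (truncatedExp t K).continuous.measurable.ennreal_ofReal.aemeasurable)
      (ae_of_all _ fun x K K' h => ?_) (ae_of_all _ fun x => ?_)
    · exact ENNReal.ofReal_le_ofReal (min_le_min_left _ (by exact_mod_cast h))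
    · refine ENNReal.tendsto_ofReal (tendsto_const_nhds.congr' ?_)
      filter_upwards [tendsto_natCast_atTop_atTop.eventually_ge_atTop (Real.exp (t * x))]
        with K hK using (min_eq_left hK).symm
  have hlim : ∫⁻ x, ENNReal.ofReal (Real.exp (t * x)) ∂μ = ENNReal.ofReal m := by
    refine tendsto_nhds_unique hmono ((ENNReal.tendsto_ofReal hm).congr fun K => ?_)
    exact ofReal_integral_eq_lintegral_ofReal ((truncatedExp t K).integrable μ)
      (ae_of_all _ (hnonneg K))
  rw [mgf, integral_eq_lintegral_of_nonneg_ae (ae_of_all _ fun x => (Real.exp_pos _).le)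
    (by fun_prop)]
  simp only [id_eq]
  rw [hlim, ENNReal.toReal_ofReal hm0]

/-- The bound on the moment generating functions at `2 * t` makes `x ↦ e^{tx}` uniformly
integrable. -/
lemma mgf_eq_of_tendsto {ι : Type*} {L : Filter ι} [L.NeBot] {μ : ι → ProbabilityMeasure ℝ}
    {ν : ProbabilityMeasure ℝ} (hν : Tendsto μ L (𝓝 ν))
    (hexp : ∀ i, ∀ t : ℝ, Integrable (fun x => Real.exp (t * x)) (μ i)) {t m C : ℝ}
    (hC : ∀ i, mgf id (μ i : Measure ℝ) (2 * t) ≤ C)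
    (hm : Tendsto (fun i => mgf id (μ i : Measure ℝ) t) L (𝓝 m)) :
    mgf id (ν : Measure ℝ) t = m := by
  have hclose : ∀ᶠ K : ℕ in atTop, |∫ x, truncatedExp t K x ∂(ν : Measure ℝ) - m| ≤ C / K := by
    filter_upwards [eventually_gt_atTop 0] with K hK
    have htest := ProbabilityMeasure.tendsto_iff_forall_integral_tendsto.1 hν (truncatedExp t K)
    rw [abs_sub_comm]
    refine le_of_tendsto (hm.sub htest).abs (Eventually.of_forall fun i => ?_)
    exact (abs_mgf_sub_integral_truncatedExp_le (hexp i) t hK).trans (by gcongr; exact hC i)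
  refine mgf_eq_of_tendsto_integral_truncatedExp (tendsto_iff_dist_tendsto_zero.2 ?_)
  exact squeeze_zero' (Eventually.of_forall fun _ => dist_nonneg) hclose
    (tendsto_const_div_atTop_nhds_zero_nat C)

lemma eq_of_mgf_eq {μ ν : Measure ℝ} [IsProbabilityMeasure μ] [IsFiniteMeasure ν]
    (hexp : ∀ t : ℝ, Integrable (fun x => Real.exp (t * x)) μ) (h : mgf id μ = mgf id ν) :
    μ = ν := by
  refine Measure.ext_of_complexMGF_id_eq (funext fun z => eqOn_complexMGF_of_mgf h ?_)
  have huniv : integrableExpSet id μ = Set.univ := Set.eq_univ_of_forall hexp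
  simp [huniv]

/-- **Curtiss' theorem.** -/
theorem tendsto_of_tendsto_mgf {μ : ℕ → ProbabilityMeasure ℝ} {μ₀ : ProbabilityMeasure ℝ}
    (hexp : ∀ n, ∀ t : ℝ, Integrable (fun x => Real.exp (t * x)) (μ n))
    (hexp₀ : ∀ t : ℝ, Integrable (fun x => Real.exp (t * x)) μ₀)
    (h : ∀ t, Tendsto (fun n => mgf id (μ n : Measure ℝ) t) atTop (𝓝 (mgf id (μ₀ : Measure ℝ) t))) :
    Tendsto μ atTop (𝓝 μ₀) := by
  have hbdd (t : ℝ) : ∃ C, ∀ n, mgf id (μ n : Measure ℝ) t ≤ C :=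
    (h t).bddAbove_range.imp fun C hC n => hC ⟨n, rfl⟩
  have htight : IsTightMeasureSet (Set.range fun n => (μ n : Measure ℝ)) := by
    obtain ⟨C, hC⟩ := hbdd 1
    obtain ⟨C', hC'⟩ := hbdd (-1)
    exact isTightMeasureSet_range_of_mgf_le hexp (fun n => (hC n).trans (le_max_left C C'))
      fun n => (hC' n).trans (le_max_right C C')
  refine (tendsto_iff_ultrafilter _ _ _).2 fun U hU => ?_
  have hcompact : IsCompact (closure (Set.range μ)) :=
    isCompact_closure_of_isTightMeasureSet (by simpa [Set.range] using htight)
  obtain ⟨ν, -, hν⟩ := hcompact.ultrafilter_le_nhds (U.map μ)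
    (.trans (by simp) (monotone_principal subset_closure))
  have hmgf : mgf id (μ₀ : Measure ℝ) = mgf id ν := funext fun t => by
    obtain ⟨C, hC⟩ := hbdd (2 * t)
    exact (mgf_eq_of_tendsto hν hexp hC ((h t).mono_left hU)).symm
  have hν_eq : μ₀ = ν :=
    Subtype.ext (eq_of_mgf_eq (μ := (μ₀ : Measure ℝ)) (ν := (ν : Measure ℝ)) hexp₀ hmgf)
  exact hν_eq ▸ hν

section RandomVariables

variable {Ω : ℕ → Type*} [∀ n, MeasurableSpace (Ω n)] {P : ∀ n, Measure (Ω n)}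
  [∀ n, IsProbabilityMeasure (P n)] {X : ∀ n, Ω n → ℝ}

lemma tendstoInDistribution_of_tendsto_mgf {μ₀ : Measure ℝ} [IsProbabilityMeasure μ₀]
    (hX : ∀ n, AEMeasurable (X n) (P n))
    (hexp : ∀ n, ∀ t : ℝ, Integrable (fun ω => Real.exp (t * X n ω)) (P n))
    (hexp₀ : ∀ t : ℝ, Integrable (fun x => Real.exp (t * x)) μ₀)
    (h : ∀ t, Tendsto (fun n => mgf (X n) (P n) t) atTop (𝓝 (mgf id μ₀ t))) :
    TendstoInDistribution X atTop id P μ₀ where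
  forall_aemeasurable := hX
  tendsto := by
    refine tendsto_of_tendsto_mgf (fun n t => ?_) (by simpa using hexp₀) (fun t => ?_)
    · exact (integrable_map_measure (by fun_prop) (hX n)).2 (hexp n t)
    · simpa [mgf_id_map (hX _)] using h t

lemma mul_integral_le_cgf {Ω : Type*} [MeasurableSpace Ω] {P : Measure Ω} [IsProbabilityMeasure P]
    {X : Ω → ℝ} (hX : Integrable X P) {t : ℝ} (hexp : Integrable (fun ω => Real.exp (t * X ω)) P) :
    t * ∫ ω, X ω ∂P ≤ cgf X P t := by
  rw [cgf, Real.le_log_iff_exp_le (mgf_pos hexp), ← integral_const_mul]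
  exact convexOn_exp.map_integral_le Real.continuous_exp.continuousOn isClosed_univ
    (ae_of_all _ fun _ => Set.mem_univ _) (hX.const_mul t) hexp

/-- By Jensen's inequality the mean lies between the chord slopes of the cumulant generating
function on the two sides of `0`. -/
lemma tendsto_integral_of_tendsto_cgf {c : ℝ → ℝ} {d : ℝ}
    (hX : ∀ n, Integrable (X n) (P n))
    (hexp : ∀ n, ∀ t : ℝ, Integrable (fun ω => Real.exp (t * X n ω)) (P n))
    (h : ∀ t, Tendsto (fun n => cgf (X n) (P n) t) atTop (𝓝 (c t))) (hc : HasDerivAt c d 0) :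
    Tendsto (fun n => ∫ ω, X n ω ∂P n) atTop (𝓝 d) := by
  have hc0 : c 0 = 0 := tendsto_nhds_unique (h 0) (by simp)
  have hslope : Tendsto (fun t => c t / t) (𝓝[≠] 0) (𝓝 d) := by
    simpa [slope_fun_def_field, hc0] using hasDerivAt_iff_tendsto_slope.1 hc
  refine tendsto_order.2 ⟨fun a ha => ?_, fun a ha => ?_⟩
  · obtain ⟨t, hat, ht⟩ : ∃ t, a < c t / t ∧ t < 0 :=
      (((hslope.mono_left (nhdsLT_le_nhdsNE 0)).eventually_const_lt ha).and
        self_mem_nhdsWithin).exists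
    filter_upwards [((h t).div_const t).eventually_const_lt hat] with n hn
    exact hn.trans_le ((div_le_iff_of_neg' ht).2 (mul_integral_le_cgf (hX n) (hexp n t)))
  · obtain ⟨t, hat, ht⟩ : ∃ t, c t / t < a ∧ 0 < t :=
      (((hslope.mono_left (nhdsGT_le_nhdsNE 0)).eventually_lt_const ha).and
        self_mem_nhdsWithin).exists
    filter_upwards [((h t).div_const t).eventually_lt_const hat] with n hn
    exact ((le_div_iff₀' ht).2 (mul_integral_le_cgf (hX n) (hexp n t))).trans_lt hn

theorem tendstoInDistribution_sub_integral_of_tendsto_cgf {v : ℝ≥0}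
    (hX : ∀ n, Integrable (X n) (P n))
    (hexp : ∀ n, ∀ t : ℝ, Integrable (fun ω => Real.exp (t * X n ω)) (P n))
    (h : ∀ t, Tendsto (fun n => cgf (X n) (P n) t) atTop (𝓝 (v * t ^ 2 / 2))) :
    TendstoInDistribution (fun n ω => X n ω - ∫ ω', X n ω' ∂P n) atTop id P (gaussianReal 0 v) := by
  have hmean : Tendsto (fun n => ∫ ω, X n ω ∂P n) atTop (𝓝 0) := by
    refine tendsto_integral_of_tendsto_cgf hX hexp h ?_
    simpa using (((hasDerivAt_id (0 : ℝ)).pow 2).const_mul (v : ℝ)).div_const 2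
  refine tendstoInDistribution_of_tendsto_mgf
    (fun n => ((hX n).sub (integrable_const _)).aemeasurable) (fun n t => ?_)
    integrable_exp_mul_gaussianReal fun t => ?_
  · simp only [mul_sub, Real.exp_sub]
    exact (hexp n t).div_const _
  · have hlim := (Real.continuous_exp.tendsto _).comp ((h t).sub (hmean.const_mul t))
    rw [mul_zero, sub_zero] at hlim
    rw [mgf_gaussianReal Measure.map_id, zero_mul, zero_add]
    refine hlim.congr fun n => ?_
    simp only [Function.comp_apply, sub_eq_add_neg, mgf_add_const]
    rw [Real.exp_add, exp_cgf (hexp n t), mul_neg]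

end RandomVariables

/-! ### Spin sums on 2-regular multigraphs -/

namespace Multigraph

section TwoRegular

variable {V : Type} (G : Multigraph V)

/-- A multigraph is 2-regular if every vertex is the end of exactly two edges, where a self-loop
counts twice: the multiset of all edge ends consists of two copies of the vertex set. -/
def IsTwoRegular [Fintype V] : Prop :=
  G.edges.bind Sym2.toMultiset = 2 • (Finset.univ : Finset V).val

/-- A colouring of the vertices is monochromatic if the ends of every edge have equal colours. -/
def IsMono {T : Type*} (y : V → T) : Prop :=
  ∀ v w, s(v, w) ∈ G.edges → y v = y w

/-- The connected components of a multigraph. -/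
abbrev Component : Type := Quot fun v w => s(v, w) ∈ G.edges

instance [Finite V] : Fintype G.Component := Fintype.ofFinite _

variable {G}

/-- The number of vertices of a connected component. -/
def Component.size (k : G.Component) : ℕ := Nat.card {v : V // Quot.mk _ v = k}

lemma Component.sum_size [Fintype V] : ∑ k : G.Component, k.size = Fintype.card V := by
  classical
  simp only [Component.size]
  rw [← Nat.card_sigma, ← Nat.card_eq_fintype_card]
  exact Nat.card_congr (Equiv.sigmaFiberEquiv _)

/-- A monochromatic colouring is a colouring of the connected components. -/
def monoEquiv (G : Multigraph V) (T : Type*) : {y : V → T // G.IsMono y} ≃ (G.Component → T) where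
  toFun y := Quot.lift y.1 y.2
  invFun τ := ⟨fun v => τ (Quot.mk _ v), fun _ _ h => congrArg τ (Quot.sound h)⟩
  left_inv _ := rfl
  right_inv _ := funext (Quot.ind fun _ => rfl)

open scoped Classical in
lemma sum_mono_prod_eq_prod_component [Fintype V] [DecidableEq V] {T R : Type*} [Fintype T]
    [CommSemiring R] (l : T → R) :
    ∑ y : V → T with G.IsMono y, ∏ v, l (y v) = ∏ k : G.Component, ∑ t, l t ^ k.size := by
  rw [Finset.sum_subtype (p := G.IsMono) _ (by simp), Finset.prod_univ_sum, Fintype.piFinset_univ]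
  refine Fintype.sum_equiv (G.monoEquiv T) _ _ fun y => ?_
  rw [← Fintype.prod_fiberwise (fun v => (Quot.mk _ v : G.Component))]
  refine Finset.prod_congr rfl fun k _ => ?_
  have hcolour (v : {v : V // (Quot.mk _ v : G.Component) = k}) :
      l (y.1 v) = l (G.monoEquiv T y k) := by
    obtain ⟨v, rfl⟩ := v
    rfl
  simp only [hcolour, Finset.prod_const, Finset.card_univ, Component.size,
    Nat.card_eq_fintype_card]

lemma IsTwoRegular.exists_halfEdges [Fintype V] (hG : G.IsTwoRegular) :
    ∃ (E : Type) (_ : Fintype E) (φ : E × Bool ≃ V × Bool),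
      G.edges = Finset.univ.val.map fun e => s((φ (e, false)).1, (φ (e, true)).1) := by
  classical
  let endpoint : G.edges × Bool → V := fun h => cond h.2 h.1.1.out.2 h.1.1.out.1
  have hedges : G.edges = Finset.univ.val.map fun e : G.edges =>
      s(endpoint (e, false), endpoint (e, true)) := by
    conv_lhs => rw [← Multiset.map_univ_coe G.edges]
    exact Multiset.map_congr rfl fun e _ => (Quot.out_eq e.1).symm
  have hcard (v : V) : Fintype.card {h // endpoint h = v} = Fintype.card Bool := by
    have hcount := congrArg (Multiset.count v) hG
    rw [hedges, Multiset.bind_map, Multiset.count_bind, Multiset.count_nsmul,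
      Multiset.count_univ] at hcount
    rw [Fintype.card_bool, Fintype.card_subtype, Finset.card_filter, Fintype.sum_prod_type]
    rw [← hcount.trans (mul_one 2)]
    refine Finset.sum_congr rfl fun e _ => ?_
    have hpair : Sym2.toMultiset s(endpoint (e, false), endpoint (e, true))
        = {endpoint (e, false), endpoint (e, true)} := rfl
    rw [hpair, Fintype.sum_bool, Multiset.insert_eq_cons, Multiset.count_cons,
      Multiset.count_singleton]
    simp only [eq_comm]
  refine ⟨G.edges, inferInstance, (Equiv.sigmaFiberEquiv endpoint).symm.trans <|
    (Equiv.sigmaCongrRight fun v => Fintype.equivOfCardEq (hcard v)).trans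
      (Equiv.sigmaEquivProd V Bool), hedges⟩

end TwoRegular
end Multigraph

lemma sum_singleton_comp {α T : Type*} [Fintype α] (f : α → T) :
    ∑ a, ({f a} : Multiset T) = Finset.univ.val.map f := by
  rw [← Multiset.sum_map_singleton (Finset.univ.val.map f), Multiset.map_map]
  rfl

section HalfEdges

variable {V E S T R : Type*}

lemma prod_comp_eq_prod_comp_of_halfEdges [Fintype V] [Fintype E] [CommMonoid R]
    (φ : E × Bool ≃ V × Bool) {τ : E → T} {y : V → T}
    (hτy : ∀ h, τ h.1 = y (φ h).1) (l : T → R) : ∏ e, l (τ e) = ∏ v, l (y v) := by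
  have htwo : 2 • ∑ e, ({τ e} : Multiset T) = 2 • ∑ v, ({y v} : Multiset T) := by
    calc 2 • ∑ e, ({τ e} : Multiset T) = ∑ h : E × Bool, {τ h.1} := by
          simp [Fintype.sum_prod_type, Finset.smul_sum]
      _ = ∑ h : V × Bool, {y h.1} := by
          simp only [hτy]
          exact Equiv.sum_comp φ fun h => {y h.1}
      _ = 2 • ∑ v, ({y v} : Multiset T) := by
          simp [Fintype.sum_prod_type, Finset.smul_sum]
  have hcolours : Finset.univ.val.map τ = Finset.univ.val.map y := by
    rw [← sum_singleton_comp, ← sum_singleton_comp]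
    exact nsmul_right_injective two_ne_zero htwo
  simpa [Multiset.map_map] using congrArg (fun s => (s.map l).prod) hcolours

open scoped Classical in
lemma sum_spin_prod_halfEdges [Fintype V] [Fintype E] [Fintype S] [Fintype T] [CommRing R]
    (φ : E × Bool ≃ V × Bool) {U : S → T → R} (l : T → R)
    (hU : ∀ t t', ∑ x, U x t * U x t' = if t = t' then 1 else 0) :
    ∑ σ : V → S, ∏ e, ∑ t, l t * (U (σ (φ (e, false)).1) t * U (σ (φ (e, true)).1) t)
      = ∑ τ : E → T with ∀ v, τ (φ.symm (v, false)).1 = τ (φ.symm (v, true)).1, ∏ e, l (τ e) := by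
  have hvertex (τ : E → T) :
      ∑ σ : V → S, ∏ e, (U (σ (φ (e, false)).1) (τ e) * U (σ (φ (e, true)).1) (τ e))
        = if ∀ v, τ (φ.symm (v, false)).1 = τ (φ.symm (v, true)).1 then 1 else 0 := by
    calc _ = ∑ σ : V → S, ∏ v, (U (σ v) (τ (φ.symm (v, false)).1) *
              U (σ v) (τ (φ.symm (v, true)).1)) := by
          refine Finset.sum_congr rfl fun σ _ => ?_
          have := Equiv.prod_comp φ fun h => U (σ h.1) (τ (φ.symm h).1)
          simpa [Fintype.prod_prod_type, Fintype.prod_bool, mul_comm] using this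
      _ = ∏ v, ∑ x, U x (τ (φ.symm (v, false)).1) * U x (τ (φ.symm (v, true)).1) := by
          rw [Finset.prod_univ_sum, Fintype.piFinset_univ]
      _ = _ := by simp only [hU, Finset.prod_ite_zero, Finset.mem_univ, true_implies,
          Finset.prod_const_one]
  calc _ = ∑ σ : V → S, ∑ τ : E → T, (∏ e, l (τ e)) *
            ∏ e, (U (σ (φ (e, false)).1) (τ e) * U (σ (φ (e, true)).1) (τ e)) := by
        refine Finset.sum_congr rfl fun σ _ => ?_
        rw [Finset.prod_univ_sum, Fintype.piFinset_univ]
        simp only [Finset.prod_mul_distrib]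
    _ = _ := by
        rw [Finset.sum_comm, Finset.sum_filter]
        simp only [← Finset.mul_sum, hvertex, mul_ite, mul_one, mul_zero]

lemma apply_halfEdge_eq_of_mono {φ : E × Bool ≃ V × Bool} {y : V → T}
    (hy : ∀ e, y (φ (e, false)).1 = y (φ (e, true)).1) (h : E × Bool) :
    y (φ (h.1, false)).1 = y (φ h).1 := by
  obtain ⟨e, _ | _⟩ := h
  exacts [rfl, hy e]

open scoped Classical in
lemma sum_edgeColouring_eq_sum_mono [Fintype V] [Fintype E] [Fintype T] [CommSemiring R]
    (φ : E × Bool ≃ V × Bool) (l : T → R) :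
    ∑ τ : E → T with ∀ v, τ (φ.symm (v, false)).1 = τ (φ.symm (v, true)).1, ∏ e, l (τ e)
      = ∑ y : V → T with ∀ e, y (φ (e, false)).1 = y (φ (e, true)).1, ∏ v, l (y v) := by
  have hedge {τ : E → T} (hτ : ∀ v, τ (φ.symm (v, false)).1 = τ (φ.symm (v, true)).1)
      (h : E × Bool) : τ (φ.symm ((φ h).1, false)).1 = τ h.1 := by
    rw [apply_halfEdge_eq_of_mono hτ, φ.symm_apply_apply]
  have hvertex {y : V → T} (hy : ∀ e, y (φ (e, false)).1 = y (φ (e, true)).1)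
      (h : V × Bool) : y (φ ((φ.symm h).1, false)).1 = y h.1 := by
    rw [apply_halfEdge_eq_of_mono hy, φ.apply_symm_apply]
  refine Finset.sum_bij' (fun τ _ v => τ (φ.symm (v, false)).1)
    (fun y _ e => y (φ (e, false)).1) ?_ ?_ ?_ ?_ ?_ <;>
    simp only [Finset.mem_filter, Finset.mem_univ, true_and]
  · exact fun τ hτ e => (hedge hτ (e, false)).trans (hedge hτ (e, true)).symm
  · exact fun y hy v => (hvertex hy (v, false)).trans (hvertex hy (v, true)).symm
  · exact fun τ hτ => funext fun e => hedge hτ (e, false)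
  · exact fun y hy => funext fun v => hvertex hy (v, false)
  · exact fun τ hτ => prod_comp_eq_prod_comp_of_halfEdges φ (fun h => (hedge hτ h).symm) l

end HalfEdges

namespace Multigraph

variable {V : Type} {G : Multigraph V}

lemma isMono_iff_halfEdges {E T : Type*} [Fintype E] {φ : E × Bool ≃ V × Bool}
    (hφ : G.edges = Finset.univ.val.map fun e => s((φ (e, false)).1, (φ (e, true)).1))
    {y : V → T} : G.IsMono y ↔ ∀ e, y (φ (e, false)).1 = y (φ (e, true)).1 := by
  have hmem (v w : V) : s(v, w) ∈ G.edges ↔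
      ∃ e, s((φ (e, false)).1, (φ (e, true)).1) = s(v, w) := by simp [hφ]
  refine ⟨fun hy e => hy _ _ ((hmem _ _).2 ⟨e, rfl⟩), fun hy v w hvw => ?_⟩
  obtain ⟨e, he⟩ := (hmem v w).1 hvw
  obtain ⟨rfl, rfl⟩ | ⟨rfl, rfl⟩ := Sym2.eq_iff.1 he
  exacts [hy e, (hy e).symm]

/-- Expanding every edge factor in the orthonormal basis `U` puts a colour `t` on each edge;
summing over the spin of a vertex then forces its two edges to have the same colour. -/
theorem IsTwoRegular.sum_spin_prod_edges [Fintype V] [DecidableEq V] (hG : G.IsTwoRegular)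
    {S T R : Type*} [Fintype S] [Fintype T] [DecidableEq T] [CommRing R]
    {K : Sym2 S → R} {U : S → T → R} {l : T → R}
    (hK : ∀ x x', K s(x, x') = ∑ t, l t * (U x t * U x' t))
    (hU : ∀ t t', ∑ x, U x t * U x t' = if t = t' then 1 else 0) :
    ∑ σ : V → S, (G.edges.map fun e => K (e.map σ)).prod
      = ∏ k : G.Component, ∑ t, l t ^ k.size := by
  classical
  obtain ⟨E, _, φ, hφ⟩ := hG.exists_halfEdges
  calc ∑ σ : V → S, (G.edges.map fun e => K (e.map σ)).prod
      = ∑ σ : V → S, ∏ e,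
          ∑ t, l t * (U (σ (φ (e, false)).1) t * U (σ (φ (e, true)).1) t) := by
        simp [hφ, hK, Multiset.map_map]
    _ = ∑ y : V → T with G.IsMono y, ∏ v, l (y v) := by
        simp only [isMono_iff_halfEdges hφ]
        convert (sum_spin_prod_halfEdges φ l (U := U) ?_).trans (sum_edgeColouring_eq_sum_mono φ l)
        convert hU
    _ = ∏ k : G.Component, ∑ t, l t ^ k.size := by
        convert sum_mono_prod_eq_prod_component (G := G) l

theorem IsTwoRegular.sum_spin_prod_edges_eq_prod_eigenvalues [Fintype V] [DecidableEq V]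
    (hG : G.IsTwoRegular) {S : Type*}
    [Fintype S] [DecidableEq S] {K : Sym2 S → ℝ}
    (hK : (Matrix.of fun x x' => K s(x, x')).IsHermitian) :
    ∑ σ : V → S, (G.edges.map fun e => K (e.map σ)).prod
      = ∏ k : G.Component, ∑ t, hK.eigenvalues t ^ k.size := by
  let U : Matrix S S ℝ := hK.eigenvectorUnitary
  refine hG.sum_spin_prod_edges (U := U) (fun x x' => ?_) fun t t' => ?_
  · have := congrFun (congrFun hK.spectral_theorem x) x'
    simpa [U, Matrix.mul_apply, Matrix.diagonal_apply, mul_assoc, mul_left_comm] using this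
  · have := congrFun (congrFun (Unitary.coe_star_mul_self hK.eigenvectorUnitary) t) t'
    simpa [U, Matrix.mul_apply, Matrix.one_apply] using this

end Multigraph

/-! ### The partition function of a 2-regular multigraph -/

/-- The transfer matrix of the one-dimensional Ising model, as a symmetric function of two spins;
the external field is shared equally between the two edges at each vertex. -/
def transferKernel (β b : ℝ) : Sym2 ℤˣ → ℝ :=
  Sym2.lift ⟨fun x y => Real.exp (β * ((x : ℤ) * (y : ℤ)) + b / 2 * ((x : ℤ) + (y : ℤ))),
    fun x y => by ring_nf⟩

/-- Half the distance between the two eigenvalues of the transfer matrix. -/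
def halfGap (β b : ℝ) : ℝ := √(Real.exp β ^ 2 * Real.sinh b ^ 2 + Real.exp (-β) ^ 2)

/-- The larger eigenvalue of the transfer matrix. -/
def upperEigenvalue (β b : ℝ) : ℝ := Real.exp β * Real.cosh b + halfGap β b

/-- The smaller eigenvalue of the transfer matrix; it is negative for `β < 0`. -/
def lowerEigenvalue (β b : ℝ) : ℝ := Real.exp β * Real.cosh b - halfGap β b

lemma halfGap_pos (β b : ℝ) : 0 < halfGap β b := Real.sqrt_pos.2 (by positivity)

lemma halfGap_sq (β b : ℝ) :
    halfGap β b ^ 2 = Real.exp β ^ 2 * Real.sinh b ^ 2 + Real.exp (-β) ^ 2 :=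
  Real.sq_sqrt (by positivity)

lemma upperEigenvalue_pos (β b : ℝ) : 0 < upperEigenvalue β b :=
  add_pos (mul_pos (Real.exp_pos _) (Real.cosh_pos _)) (halfGap_pos β b)

lemma upperEigenvalue_mul_lowerEigenvalue (β b : ℝ) :
    upperEigenvalue β b * lowerEigenvalue β b = Real.exp β ^ 2 - Real.exp (-β) ^ 2 := by
  rw [upperEigenvalue, lowerEigenvalue, ← sq_sub_sq, halfGap_sq, mul_pow, Real.cosh_sq]
  ring

lemma pow_add_pow_eq_of_add_eq_of_mul_eq {R : Type*} [CommRing R] [NoZeroDivisors R]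
    {a b c d : R} (hadd : a + b = c + d) (hmul : a * b = c * d) (n : ℕ) :
    a ^ n + b ^ n = c ^ n + d ^ n := by
  have hroot : (a - c) * (a - d) = 0 := by linear_combination a * hadd - hmul
  rcases mul_eq_zero.1 hroot with h | h
  · obtain rfl := sub_eq_zero.1 h
    rw [add_left_cancel hadd]
  · obtain rfl := sub_eq_zero.1 h
    rw [add_left_cancel (hadd.trans (add_comm _ _)), add_comm]

lemma isHermitian_transferKernel (β b : ℝ) :
    (Matrix.of fun x x' => transferKernel β b s(x, x')).IsHermitian :=
  Matrix.IsHermitian.ext fun x x' => by simp [Sym2.eq_swap]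

lemma det_units_int {R : Type*} [CommRing R] (A : Matrix ℤˣ ℤˣ R) :
    A.det = A 1 1 * A (-1) (-1) - A 1 (-1) * A (-1) 1 := by
  have hperm : (Finset.univ : Finset (Equiv.Perm ℤˣ)) = {1, Equiv.swap 1 (-1)} := by decide
  rw [Matrix.det_apply, hperm, Finset.sum_pair (by decide)]
  simp [sub_eq_add_neg, mul_comm]

lemma sum_eigenvalues_pow_transferKernel (β b : ℝ) (n : ℕ) :
    ∑ t, (isHermitian_transferKernel β b).eigenvalues t ^ n
      = upperEigenvalue β b ^ n + lowerEigenvalue β b ^ n := by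
  have hne : (1 : ℤˣ) ≠ -1 := by decide
  have hup : transferKernel β b s(1, 1) = Real.exp β * Real.exp b := by
    rw [← Real.exp_add]
    norm_num [transferKernel]
  have hdown : transferKernel β b s(-1, -1) = Real.exp β * Real.exp (-b) := by
    rw [← Real.exp_add]
    norm_num [transferKernel]
  have hflip (x : ℤˣ) : transferKernel β b s(x, -x) = Real.exp (-β) := by
    simp [transferKernel, ← Int.cast_mul, ← Units.val_mul]
  have htrace := (isHermitian_transferKernel β b).trace_eq_sum_eigenvalues
  have hdet := (isHermitian_transferKernel β b).det_eq_prod_eigenvalues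
  have hflip' := hflip (-1)
  rw [neg_neg] at hflip'
  simp only [Matrix.trace, Matrix.diag_apply, Matrix.of_apply, UnitsInt.univ,
    Finset.sum_pair hne, hup, hdown, RCLike.ofReal_real_eq_id, id] at htrace
  simp only [det_units_int, Matrix.of_apply, UnitsInt.univ, Finset.prod_pair hne,
    hup, hdown, hflip, hflip', RCLike.ofReal_real_eq_id, id] at hdet
  rw [UnitsInt.univ, Finset.sum_pair hne]
  refine pow_add_pow_eq_of_add_eq_of_mul_eq ?_ ?_ n
  · rw [← htrace, upperEigenvalue, lowerEigenvalue, Real.cosh_eq]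
    ring
  · have hexp : Real.exp b * Real.exp (-b) = 1 := by simp [← Real.exp_add]
    rw [← hdet, upperEigenvalue_mul_lowerEigenvalue]
    linear_combination Real.exp β ^ 2 * hexp

lemma two_mul_totalSpin {N : ℕ} {G : Multigraph (Fin N)} (hG : G.IsTwoRegular)
    (σ : SpinConfig N) :
    2 * totalSpin σ = (G.edges.map fun e => (e.toMultiset.map (spin σ)).sum).sum := by
  rw [← Multiset.sum_bind, ← Multiset.map_bind, hG, Multiset.map_nsmul, Multiset.sum_nsmul,
    nsmul_eq_mul]
  rfl

lemma boltzmannWeight_eq_prod_transferKernel {N : ℕ} {G : Multigraph (Fin N)}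
    (hG : G.IsTwoRegular) (β b : ℝ) (σ : SpinConfig N) :
    boltzmannWeight G β b σ = (G.edges.map fun e => transferKernel β b (e.map σ)).prod := by
  have hedge (e : Sym2 (Fin N)) : transferKernel β b (e.map σ) = Real.exp
      (β * Sym2.lift ⟨fun i j => spin σ i * spin σ j, fun _ _ => mul_comm _ _⟩ e
        + b / 2 * (e.toMultiset.map (spin σ)).sum) := by
    induction e with
    | _ i j => simp [transferKernel, spin, Sym2.toMultiset]
  have hfield : b * totalSpin σ = b / 2 * (2 * totalSpin σ) := by ring
  rw [boltzmannWeight, hfield, two_mul_totalSpin hG, edgeSum, ← Multiset.sum_map_mul_left,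
    ← Multiset.sum_map_mul_left, ← Multiset.sum_map_add, Real.exp_multiset_sum, Multiset.map_map]
  simp only [hedge, Function.comp_def]

theorem partitionFunction_eq_prod_component {N : ℕ} {G : Multigraph (Fin N)}
    (hG : G.IsTwoRegular) (β b : ℝ) :
    partitionFunction G β b
      = ∏ k : G.Component, (upperEigenvalue β b ^ k.size + lowerEigenvalue β b ^ k.size) := by
  simp only [partitionFunction, boltzmannWeight_eq_prod_transferKernel hG,
    hG.sum_spin_prod_edges_eq_prod_eigenvalues (isHermitian_transferKernel β b),
    sum_eigenvalues_pow_transferKernel]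

lemma isTwoRegular_cycle (N : ℕ) : (cycle N).IsTwoRegular := by
  have hends (i : Fin N) : Sym2.toMultiset s(i, finRotate N i) = i ::ₘ {finRotate N i} := rfl
  have hrot : Finset.univ.val.map (finRotate N) = (Finset.univ : Finset (Fin N)).val :=
    Multiset.map_univ_val_equiv _
  rw [Multigraph.IsTwoRegular, cycle, Multiset.bind_map]
  simp only [hends, Multiset.bind_cons, Multiset.bind_singleton, Multiset.map_id', hrot, two_nsmul]

lemma toMultiset_map {α β : Type*} (f : α → β) (e : Sym2 α) :
    (e.map f).toMultiset = e.toMultiset.map f := by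
  induction e with
  | _ x y => rfl

lemma Pairing.mk_eq_of_mem {N : ℕ} {d : Fin N → ℕ} (π : Pairing d) {h h' : HalfEdge d}
    (hmem : h' ∈ s(h, π.1 h)) : s(h', π.1 h') = s(h, π.1 h) := by
  rcases Sym2.mem_iff.1 hmem with rfl | rfl
  · rfl
  · rw [(π.2 h).2, Sym2.eq_swap]

lemma Pairing.bind_toMultiset {N : ℕ} {d : Fin N → ℕ} (π : Pairing d) :
    (Finset.univ.image fun h => s(h, π.1 h)).val.bind Sym2.toMultiset
      = (Finset.univ : Finset (HalfEdge d)).val := by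
  have hmem {e : Sym2 (HalfEdge d)} (he : e ∈ Finset.univ.image fun h => s(h, π.1 h))
      {h : HalfEdge d} (hh : h ∈ e.toMultiset) : e = s(h, π.1 h) := by
    obtain ⟨h', -, rfl⟩ := Finset.mem_image.1 he
    exact (π.mk_eq_of_mem (Sym2.mem_toMultiset.1 hh)).symm
  refine (Multiset.Nodup.ext (Multiset.nodup_bind.2 ⟨fun e he => ?_, ?_⟩)
    Finset.univ.nodup).2 fun h => ?_
  · obtain ⟨h, -, rfl⟩ := Finset.mem_image.1 he
    simpa [Sym2.toMultiset] using (π.2 h).1.symm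
  · refine Multiset.Nodup.pairwise (fun e he e' he' hne => ?_) (Finset.nodup _)
    exact Multiset.disjoint_left.2 fun hh hh' => hne ((hmem he hh).trans (hmem he' hh').symm)
  · simp only [Multiset.mem_bind, Finset.mem_val, Finset.mem_univ, iff_true]
    exact ⟨_, Finset.mem_image_of_mem _ (Finset.mem_univ h), by simp⟩

lemma Pairing.isTwoRegular_toMultigraph {N : ℕ} (π : Pairing fun _ : Fin N => 2) :
    π.toMultigraph.IsTwoRegular := by
  rw [Multigraph.IsTwoRegular, Pairing.toMultigraph, Multiset.bind_map]
  simp only [toMultiset_map]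
  rw [← Multiset.map_bind, π.bind_toMultiset]
  have huniv : (Finset.univ : Finset (HalfEdge fun _ : Fin N => 2)).val
      = Finset.univ.val.bind fun i => (Finset.univ : Finset (Fin 2)).val.map (Sigma.mk i) := rfl
  have hfst (i : Fin N) : ((Finset.univ : Finset (Fin 2)).val.map (Sigma.mk i)).map
      (Sigma.fst : HalfEdge (fun _ : Fin N => 2) → Fin N) = i ::ₘ {i} := rfl
  simp only [huniv, Multiset.map_bind, hfst, Multiset.bind_cons, Multiset.map_id', two_nsmul]
  exact congrArg _ ((Multiset.bind_singleton _ id).trans (Multiset.map_id _))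

lemma Pairing.isMono_toMultigraph {N : ℕ} {d : Fin N → ℕ} (π : Pairing d) {T : Type*}
    {y : Fin N → T} : π.toMultigraph.IsMono y ↔ ∀ h, y (π.1 h).1 = y h.1 := by
  have hmem (v w : Fin N) : s(v, w) ∈ π.toMultigraph.edges ↔
      ∃ h : HalfEdge d, s(h.1, (π.1 h).1) = s(v, w) := by simp [Pairing.toMultigraph]
  refine ⟨fun hy h => (hy _ _ ((hmem _ _).2 ⟨h, rfl⟩)).symm, fun hy v w hvw => ?_⟩
  obtain ⟨h, hh⟩ := (hmem v w).1 hvw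
  obtain ⟨rfl, rfl⟩ | ⟨rfl, rfl⟩ := Sym2.eq_iff.1 hh
  exacts [(hy h).symm, hy h]

/-! ### The one-dimensional model -/

/-- The ratio of the eigenvalues of the transfer matrix. -/
def eigenRatio (β b : ℝ) : ℝ := lowerEigenvalue β b / upperEigenvalue β b

/-- The magnetization per site of the infinite one-dimensional Ising model. -/
def lineMagnetization (β b : ℝ) : ℝ := Real.exp β * Real.sinh b / halfGap β b

/-- The susceptibility of the infinite one-dimensional Ising model. -/
def lineSusceptibility (β b : ℝ) : ℝ :=
  Real.exp β * Real.exp (-β) ^ 2 * Real.cosh b / halfGap β b ^ 3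

lemma abs_eigenRatio_lt_one (β b : ℝ) : |eigenRatio β b| < 1 := by
  have hgap := halfGap_pos β b
  have hcosh := mul_pos (Real.exp_pos β) (Real.cosh_pos b)
  rw [eigenRatio, abs_div, abs_of_pos (upperEigenvalue_pos β b),
    div_lt_one (upperEigenvalue_pos β b), abs_lt, upperEigenvalue, lowerEigenvalue]
  constructor <;> linarith

lemma one_add_eigenRatio_pow_pos (β b : ℝ) (L : ℕ) : 0 < 1 + eigenRatio β b ^ L := by
  rcases L with _ | L
  · simp
  · have := abs_lt.1 ((abs_pow (eigenRatio β b) (L + 1)).trans_lt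
      (pow_lt_one₀ (abs_nonneg _) (abs_eigenRatio_lt_one β b) L.succ_ne_zero))
    linarith [this.1]

lemma upperEigenvalue_pow_add_lowerEigenvalue_pow (β b : ℝ) (L : ℕ) :
    upperEigenvalue β b ^ L + lowerEigenvalue β b ^ L
      = upperEigenvalue β b ^ L * (1 + eigenRatio β b ^ L) := by
  have := (upperEigenvalue_pos β b).ne'
  rw [eigenRatio, div_pow]
  field_simp

lemma lineSusceptibility_pos (β b : ℝ) : 0 < lineSusceptibility β b := by
  have := halfGap_pos β b
  have := Real.cosh_pos b
  rw [lineSusceptibility]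
  positivity

lemma halfGap_eq_exp_mul_sqrt (β b : ℝ) :
    halfGap β b = Real.exp β * √(Real.sinh b ^ 2 + Real.exp (-4 * β)) := by
  have hexp : Real.exp (-β) ^ 2 = Real.exp β ^ 2 * Real.exp (-4 * β) := by
    rw [← Real.exp_nat_mul, ← Real.exp_nat_mul, ← Real.exp_add]
    ring_nf
  rw [halfGap, hexp, ← mul_add, Real.sqrt_mul (by positivity), Real.sqrt_sq (Real.exp_pos β).le]

lemma lineSusceptibility_eq (β b : ℝ) :
    lineSusceptibility β b = Real.cosh b * Real.exp (-4 * β) /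
      (Real.sinh b ^ 2 + Real.exp (-4 * β)) ^ (3 / 2 : ℝ) := by
  set D := Real.sinh b ^ 2 + Real.exp (-4 * β) with hD
  have hD0 : 0 < D := by positivity
  have hrpow : D ^ (3 / 2 : ℝ) = √D ^ 3 := by
    rw [Real.sqrt_eq_rpow, ← Real.rpow_natCast, ← Real.rpow_mul hD0.le]
    norm_num
  have hexp : Real.exp β * Real.exp (-β) ^ 2 = Real.exp (-4 * β) * Real.exp β ^ 3 := by
    rw [← Real.exp_nat_mul, ← Real.exp_nat_mul, ← Real.exp_add, ← Real.exp_add]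
    ring_nf
  rw [lineSusceptibility, halfGap_eq_exp_mul_sqrt, ← hD, hrpow, hexp, mul_pow]
  have : √D ≠ 0 := (Real.sqrt_pos.2 hD0).ne'
  field_simp

lemma hasDerivAt_halfGap (β b : ℝ) :
    HasDerivAt (halfGap β) (Real.exp β ^ 2 * Real.sinh b * Real.cosh b / halfGap β b) b := by
  have h : HasDerivAt (fun b => Real.exp β ^ 2 * Real.sinh b ^ 2 + Real.exp (-β) ^ 2)
      (Real.exp β ^ 2 * (((2 : ℕ) : ℝ) * Real.sinh b ^ (2 - 1) * Real.cosh b)) b :=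
    (((Real.hasDerivAt_sinh b).pow 2).const_mul _).add_const _
  refine (h.sqrt (by positivity)).congr_deriv ?_
  rw [← halfGap]
  have := (halfGap_pos β b).ne'
  field_simp
  push_cast
  ring

lemma hasDerivAt_upperEigenvalue (β b : ℝ) :
    HasDerivAt (upperEigenvalue β) (lineMagnetization β b * upperEigenvalue β b) b := by
  refine (((Real.hasDerivAt_cosh b).const_mul (Real.exp β)).add
    (hasDerivAt_halfGap β b)).congr_deriv ?_
  have := (halfGap_pos β b).ne'
  rw [upperEigenvalue, lineMagnetization]
  field_simp
  ring

lemma hasDerivAt_lowerEigenvalue (β b : ℝ) :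
    HasDerivAt (lowerEigenvalue β) (-lineMagnetization β b * lowerEigenvalue β b) b := by
  refine (((Real.hasDerivAt_cosh b).const_mul (Real.exp β)).sub
    (hasDerivAt_halfGap β b)).congr_deriv ?_
  have := (halfGap_pos β b).ne'
  rw [lowerEigenvalue, lineMagnetization]
  field_simp
  ring

lemma hasDerivAt_eigenRatio (β b : ℝ) :
    HasDerivAt (eigenRatio β) (-2 * lineMagnetization β b * eigenRatio β b) b := by
  have hne := (upperEigenvalue_pos β b).ne'
  refine ((hasDerivAt_lowerEigenvalue β b).div (hasDerivAt_upperEigenvalue β b)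
    hne).congr_deriv ?_
  rw [eigenRatio]
  field_simp
  ring

lemma hasDerivAt_lineMagnetization (β b : ℝ) :
    HasDerivAt (lineMagnetization β) (lineSusceptibility β b) b := by
  have hne := (halfGap_pos β b).ne'
  refine (((Real.hasDerivAt_sinh b).const_mul (Real.exp β)).div (hasDerivAt_halfGap β b)
    hne).congr_deriv ?_
  have := halfGap_sq β b
  rw [lineSusceptibility]
  field_simp
  rw [this]
  ring

/-! ### The quenched susceptibility -/

lemma hasDerivAt_pow_of_hasDerivAt_mul {𝕜 : Type*} [NontriviallyNormedField 𝕜] {f : 𝕜 → 𝕜}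
    {c x : 𝕜} (hf : HasDerivAt f (c * f x) x) (n : ℕ) :
    HasDerivAt (fun y => f y ^ n) (n * c * f x ^ n) x := by
  refine (hf.pow n).congr_deriv ?_
  rcases n with _ | n
  · simp
  · rw [Nat.add_sub_cancel]
    ring

/-- The difference between the total magnetization of the cycle of length `L` and that of `L`
sites of the infinite line. -/
def cycleDeviation (β : ℝ) (L : ℕ) (b : ℝ) : ℝ :=
  -2 * lineMagnetization β b * (L * eigenRatio β b ^ L / (1 + eigenRatio β b ^ L))

lemma hasDerivAt_upperEigenvalue_pow_add_lowerEigenvalue_pow (β b : ℝ) (L : ℕ) :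
    HasDerivAt (fun b => upperEigenvalue β b ^ L + lowerEigenvalue β b ^ L)
      (L * lineMagnetization β b * (upperEigenvalue β b ^ L - lowerEigenvalue β b ^ L)) b := by
  refine ((hasDerivAt_pow_of_hasDerivAt_mul (hasDerivAt_upperEigenvalue β b) L).add
    (hasDerivAt_pow_of_hasDerivAt_mul (hasDerivAt_lowerEigenvalue β b) L)).congr_deriv ?_
  ring

lemma logDeriv_upperEigenvalue_pow_add_lowerEigenvalue_pow (β b : ℝ) (L : ℕ) :
    logDeriv (fun b => upperEigenvalue β b ^ L + lowerEigenvalue β b ^ L) b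
      = L * lineMagnetization β b + cycleDeviation β L b := by
  have hupper := (upperEigenvalue_pos β b).ne'
  have hne := (one_add_eigenRatio_pow_pos β b L).ne'
  have hlower : lowerEigenvalue β b = upperEigenvalue β b * eigenRatio β b :=
    (mul_div_cancel₀ _ hupper).symm
  rw [logDeriv_apply, (hasDerivAt_upperEigenvalue_pow_add_lowerEigenvalue_pow β b L).deriv,
    cycleDeviation, upperEigenvalue_pow_add_lowerEigenvalue_pow, hlower, mul_pow]
  field_simp
  ring

lemma hasDerivAt_cycleDeviation (β b : ℝ) (L : ℕ) :
    HasDerivAt (cycleDeviation β L)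
      (-2 * lineSusceptibility β b * (L * eigenRatio β b ^ L / (1 + eigenRatio β b ^ L)) +
        4 * lineMagnetization β b ^ 2 *
          (L ^ 2 * eigenRatio β b ^ L / (1 + eigenRatio β b ^ L) ^ 2)) b := by
  have hne := (one_add_eigenRatio_pow_pos β b L).ne'
  have hpow := hasDerivAt_pow_of_hasDerivAt_mul (hasDerivAt_eigenRatio β b) L
  refine (((hasDerivAt_lineMagnetization β b).const_mul (-2)).mul
    ((hpow.const_mul (L : ℝ)).div (hpow.const_add 1) hne)).congr_deriv ?_
  simp only [Pi.div_apply]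
  field_simp
  ring

lemma tendsto_deriv_cycleDeviation (β b : ℝ) :
    Tendsto (fun L => deriv (cycleDeviation β L) b) atTop (𝓝 0) := by
  have hr := abs_eigenRatio_lt_one β b
  have hpow (k : ℕ) : Tendsto (fun L : ℕ => (L : ℝ) ^ k * eigenRatio β b ^ L) atTop (𝓝 0) :=
    tendsto_pow_const_mul_const_pow_of_abs_lt_one k hr
  have hden : Tendsto (fun L : ℕ => 1 + eigenRatio β b ^ L) atTop (𝓝 (1 + 0)) :=
    (tendsto_pow_atTop_nhds_zero_of_abs_lt_one hr).const_add 1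
  have hlim := (((hpow 1).div hden (by norm_num)).const_mul (-2 * lineSusceptibility β b)).add
    (((hpow 2).div (hden.pow 2) (by norm_num)).const_mul (4 * lineMagnetization β b ^ 2))
  simpa [(hasDerivAt_cycleDeviation β b _).deriv] using hlim

lemma partitionFunction_pos {N : ℕ} (G : Multigraph (Fin N)) (β b : ℝ) :
    0 < partitionFunction G β b :=
  Finset.sum_pos (fun σ _ => boltzmannWeight_pos G β b σ) Finset.univ_nonempty

lemma hasDerivAt_partitionFunction {N : ℕ} (G : Multigraph (Fin N)) (β b : ℝ) :
    HasDerivAt (partitionFunction G β) (∑ σ, boltzmannWeight G β b σ * totalSpin σ) b :=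
  HasDerivAt.fun_sum fun σ _ =>
    ((hasDerivAt_mul_const (x := b) (totalSpin σ)).const_add (β * edgeSum G σ)).exp

lemma magnetization_eq_logDeriv {N : ℕ} (G : Multigraph (Fin N)) (β b : ℝ) :
    magnetization G β b = logDeriv (partitionFunction G β) b / N := by
  rw [magnetization, logDeriv_apply, (hasDerivAt_partitionFunction G β b).deriv]
  simp only [div_mul_eq_mul_div, Finset.sum_div]

lemma magnetization_eq_of_isTwoRegular {N : ℕ} [NeZero N] {G : Multigraph (Fin N)}
    (hG : G.IsTwoRegular) (β b : ℝ) :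
    magnetization G β b
      = lineMagnetization β b + (∑ k : G.Component, cycleDeviation β k.size b) / N := by
  have hN : (N : ℝ) ≠ 0 := NeZero.ne _
  have hsize : ∑ k : G.Component, (k.size : ℝ) = N := by
    exact_mod_cast Multigraph.Component.sum_size.trans (Fintype.card_fin N)
  rw [magnetization_eq_logDeriv, funext (partitionFunction_eq_prod_component hG β), logDeriv_prod]
  · simp only [logDeriv_upperEigenvalue_pow_add_lowerEigenvalue_pow, Finset.sum_add_distrib,
      ← Finset.sum_mul, hsize]
    field_simp
  · intro k _
    rw [upperEigenvalue_pow_add_lowerEigenvalue_pow]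
    exact (mul_pos (pow_pos (upperEigenvalue_pos β b) _)
      (one_add_eigenRatio_pow_pos β b _)).ne'
  · exact fun k _ => (hasDerivAt_upperEigenvalue_pow_add_lowerEigenvalue_pow β b
      k.size).differentiableAt

lemma susceptibility_eq_of_isTwoRegular {N : ℕ} [NeZero N] {G : Multigraph (Fin N)}
    (hG : G.IsTwoRegular) (β b : ℝ) :
    susceptibility G β b
      = lineSusceptibility β b + (∑ k : G.Component, deriv (cycleDeviation β k.size) b) / N := by
  rw [susceptibility, funext (magnetization_eq_of_isTwoRegular hG β)]
  exact ((hasDerivAt_lineMagnetization β b).add ((HasDerivAt.fun_sum fun k _ =>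
    (hasDerivAt_cycleDeviation β b _).differentiableAt.hasDerivAt).div_const _)).deriv

lemma exists_abs_susceptibility_sub_le (β b : ℝ) :
    ∃ C, ∀ (N : ℕ) [NeZero N] (G : Multigraph (Fin N)), G.IsTwoRegular →
      |susceptibility G β b - lineSusceptibility β b| ≤ C * (Fintype.card G.Component / N) := by
  obtain ⟨C, hC⟩ := (tendsto_deriv_cycleDeviation β b).norm.bddAbove_range
  refine ⟨C, fun N _ G hG => ?_⟩
  rw [susceptibility_eq_of_isTwoRegular hG, add_sub_cancel_left, abs_div, Nat.abs_cast,
    ← mul_div_assoc]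
  gcongr
  calc |∑ k : G.Component, deriv (cycleDeviation β k.size) b|
      ≤ ∑ k : G.Component, |deriv (cycleDeviation β k.size) b| := Finset.abs_sum_le_sum_abs _ _
    _ ≤ ∑ _k : G.Component, C := Finset.sum_le_sum fun k _ => hC ⟨k.size, rfl⟩
    _ = C * Fintype.card G.Component := by
        rw [Finset.sum_const, Finset.card_univ, nsmul_eq_mul, mul_comm]

theorem tendsto_susceptibility {G : (N : ℕ) → Multigraph (Fin N)}
    (hG : ∀ᶠ N in atTop, (G N).IsTwoRegular)
    (hcard : Tendsto (fun N => (Fintype.card (G N).Component : ℝ) / N) atTop (𝓝 0)) (β b : ℝ) :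
    Tendsto (fun N => susceptibility (G N) β b) atTop (𝓝 (lineSusceptibility β b)) := by
  obtain ⟨C, hC⟩ := exists_abs_susceptibility_sub_le β b
  rw [tendsto_iff_norm_sub_tendsto_zero]
  refine squeeze_zero' (Eventually.of_forall fun _ => norm_nonneg _) ?_
    (by simpa using hcard.const_mul C)
  filter_upwards [hG, eventually_ne_atTop 0] with N hN hN0
  have : NeZero N := ⟨hN0⟩
  exact hC N (G N) hN

lemma subsingleton_component_cycle (N : ℕ) : Subsingleton (cycle N).Component := by
  rcases N with _ | N
  · exact ⟨Quot.ind fun v => v.elim0⟩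
  have hconnected (v : Fin (N + 1)) :
      (Quot.mk _ v : (cycle (N + 1)).Component) = Quot.mk _ 0 := by
    induction v using Fin.induction with
    | zero => rfl
    | succ i ih =>
      rw [← ih]
      refine (Quot.sound (Multiset.mem_map.2 ⟨i.castSucc, Finset.mem_univ_val _, ?_⟩)).symm
      rw [finRotate_apply, Fin.coeSucc_eq_succ]
  exact ⟨Quot.ind fun v => Quot.ind fun w => (hconnected v).trans (hconnected w).symm⟩

theorem tendsto_susceptibility_cycle (β b : ℝ) :
    Tendsto (fun N => susceptibility (cycle N) β b) atTop (𝓝 (lineSusceptibility β b)) := by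
  refine tendsto_susceptibility (Eventually.of_forall isTwoRegular_cycle) ?_ β b
  refine squeeze_zero (fun _ => by positivity) (fun N => ?_) tendsto_one_div_atTop_nhds_zero_nat
  gcongr
  exact_mod_cast Fintype.card_le_one_iff_subsingleton.2 (subsingleton_component_cycle N)

/-! ### Counting pairings -/

instance {N : ℕ} (d : Fin N → ℕ) : Fintype (Pairing d) := Fintype.ofFinite _

lemma integral_twoRegularCM {N : ℕ} (f : Multigraph (Fin N) → ℝ) :
    ∫ G, f G ∂twoRegularCM N = (Fintype.card (Pairing fun _ : Fin N => 2) : ℝ)⁻¹ *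
      ∑ π : Pairing fun _ : Fin N => 2, f π.toMultigraph := by
  rw [twoRegularCM, configurationModel, integral_map measurable_from_top.aemeasurable
    measurable_from_top.aestronglyMeasurable, uniformOn, ProbabilityTheory.cond,
    Measure.restrict_univ, integral_smul_measure, integral_count]
  simp

/-- Fixed-point free involutions, that is, the pairings of the elements of `α`. -/
abbrev FreeInvolution (α : Type*) : Type _ :=
  {π : Equiv.Perm α // ∀ a, π a ≠ a ∧ π (π a) = a}

instance (α : Type*) [Finite α] : Fintype (FreeInvolution α) := Fintype.ofFinite _

lemma cycleType_eq_replicate_two_iff {α : Type*} [Fintype α] [DecidableEq α] {n : ℕ}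
    (hα : Fintype.card α = 2 * n) (π : Equiv.Perm α) :
    π.cycleType = Multiset.replicate n 2 ↔ ∀ a, π a ≠ a ∧ π (π a) = a := by
  constructor
  · intro hπ a
    have hsq : π ^ 2 = 1 := Equiv.Perm.pow_prime_eq_one_iff.2 fun c hc =>
      Multiset.eq_of_mem_replicate (hπ ▸ hc)
    have hsupp : π.support = Finset.univ := by
      rw [← Finset.card_eq_iff_eq_univ, ← Equiv.Perm.sum_cycleType, hπ, hα]
      simp [mul_comm]
    exact ⟨Equiv.Perm.mem_support.1 (hsupp ▸ Finset.mem_univ a),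
      by rw [← Equiv.Perm.mul_apply, ← pow_two, hsq, Equiv.Perm.one_apply]⟩
  · intro hπ
    have hsq : π ^ 2 = 1 := Equiv.ext fun a => by simp [pow_two, (hπ a).2]
    have hsupp : π.support = Finset.univ := Finset.eq_univ_of_forall fun a => by simp [(hπ a).1]
    have htype := Equiv.Perm.cycleType_of_pow_prime_eq_one hsq
    have hsum := π.sum_cycleType
    rw [hsupp, Finset.card_univ, hα, htype, Multiset.sum_replicate, smul_eq_mul] at hsum
    rw [htype]
    congr 1
    omega

lemma card_freeInvolution_mul (α : Type*) [Fintype α] {n : ℕ} (hα : Fintype.card α = 2 * n) :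
    Fintype.card (FreeInvolution α) * (2 ^ n * n.factorial) = (2 * n).factorial := by
  classical
  have htype : Fintype.card (FreeInvolution α)
      = (Finset.univ.filter fun π : Equiv.Perm α => π.cycleType = Multiset.replicate n 2).card := by
    rw [← Fintype.card_subtype]
    exact Fintype.card_congr (Equiv.subtypeEquivRight fun π =>
      (cycleType_eq_replicate_two_iff hα π).symm)
  have hcount := Equiv.Perm.card_of_cycleType_mul_eq α (Multiset.replicate n 2)
  rw [if_pos ⟨by simp [hα, mul_comm], fun a ha => (Multiset.eq_of_mem_replicate ha).ge⟩,
    ← htype, hα] at hcount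
  rw [← hcount]
  congr 1
  rcases eq_or_ne n 0 with rfl | hn
  · simp
  · rw [Multiset.toFinset_replicate, if_neg hn]
    simp [mul_comm n 2]

/-- The fixed-point free involutions preserving a predicate split into a pair of such involutions,
one on each side. -/
def freeInvolutionPreservingEquiv {α : Type*} (p : α → Prop) [DecidablePred p] :
    {π : FreeInvolution α // ∀ a, p (π.1 a) ↔ p a} ≃
      FreeInvolution {a // p a} × FreeInvolution {a // ¬ p a} where
  toFun π := (⟨π.1.1.subtypePerm π.2, fun a => ⟨fun e => (π.1.2 a).1 (congrArg Subtype.val e),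
      Subtype.ext (π.1.2 a).2⟩⟩,
    ⟨π.1.1.subtypePerm fun a => not_congr (π.2 a),
      fun a => ⟨fun e => (π.1.2 a).1 (congrArg Subtype.val e), Subtype.ext (π.1.2 a).2⟩⟩)
  invFun q := ⟨⟨Equiv.Perm.subtypeCongr q.1.1 q.2.1, fun a => by
    by_cases ha : p a
    · rw [Equiv.Perm.subtypeCongr.left_apply _ _ ha,
        Equiv.Perm.subtypeCongr.left_apply_subtype, (q.1.2 ⟨a, ha⟩).2]
      exact ⟨fun e => (q.1.2 ⟨a, ha⟩).1 (Subtype.ext e), rfl⟩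
    · rw [Equiv.Perm.subtypeCongr.right_apply _ _ ha,
        Equiv.Perm.subtypeCongr.right_apply_subtype, (q.2.2 ⟨a, ha⟩).2]
      exact ⟨fun e => (q.2.2 ⟨a, ha⟩).1 (Subtype.ext e), rfl⟩⟩, fun a => by
    by_cases ha : p a
    · simpa only [Equiv.Perm.subtypeCongr.left_apply _ _ ha, ha, iff_true]
        using (q.1.1 ⟨a, ha⟩).2
    · simpa only [Equiv.Perm.subtypeCongr.right_apply _ _ ha, ha, iff_false]
        using (q.2.1 ⟨a, ha⟩).2⟩
  left_inv π := by
    ext a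
    by_cases ha : p a
    · simp [Equiv.Perm.subtypeCongr.left_apply _ _ ha]
    · simp [Equiv.Perm.subtypeCongr.right_apply _ _ ha]
  right_inv q := by
    ext a <;> simp

/-- The probability that the symmetric simple random walk is at `0` after `2 * n` steps. -/
def returnProb (n : ℕ) : ℝ := n.centralBinom / 4 ^ n

lemma returnProb_pos (n : ℕ) : 0 < returnProb n :=
  div_pos (Nat.cast_pos.2 n.centralBinom_pos) (by positivity)

lemma card_freeInvolution (α : Type*) [Fintype α] {n : ℕ} (hα : Fintype.card α = 2 * n) :
    (Fintype.card (FreeInvolution α) : ℝ) = 2 ^ n * n.factorial * returnProb n := by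
  have hbinom : (n.centralBinom : ℝ) * n.factorial * n.factorial = (2 * n).factorial := by
    have := Nat.choose_mul_factorial_mul_factorial (n := 2 * n) (k := n) (by lia)
    rw [← Nat.centralBinom_eq_two_mul_choose, two_mul, Nat.add_sub_cancel, ← two_mul] at this
    exact_mod_cast this
  have hcount : (Fintype.card (FreeInvolution α) : ℝ) * (2 ^ n * n.factorial)
      = (2 * n).factorial := by exact_mod_cast card_freeInvolution_mul α hα
  have hfour : (4 : ℝ) ^ n = 2 ^ n * 2 ^ n := by rw [← mul_pow]; norm_num
  refine mul_right_cancel₀ (b := (2 : ℝ) ^ n * n.factorial) (by positivity) ?_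
  rw [hcount, ← hbinom, returnProb, hfour]
  field_simp

lemma card_pairing (N : ℕ) :
    (Fintype.card (Pairing fun _ : Fin N => 2) : ℝ) = 2 ^ N * N.factorial * returnProb N := by
  rw [← card_freeInvolution (HalfEdge fun _ : Fin N => 2) (by simp [mul_comm])]
  exact congrArg _ (Fintype.card_congr (Equiv.refl _))

/-- The mean number of sets of `k` vertices that are unions of components of the 2-regular
configuration model on `N` vertices. -/
def splitCoeff (N k : ℕ) : ℝ := returnProb k * returnProb (N - k) / returnProb N

open scoped Classical in
lemma card_pairing_preserving {N : ℕ} (s : Finset (Fin N)) :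
    (Finset.card {π : Pairing (fun _ : Fin N => 2) | ∀ h, (π.1 h).1 ∈ s ↔ h.1 ∈ s} : ℝ)
        * N.choose s.card
      = Fintype.card (Pairing fun _ : Fin N => 2) * splitCoeff N s.card := by
  have hs : s.card ≤ N := (Finset.card_le_univ s).trans_eq (Fintype.card_fin N)
  let p : HalfEdge (fun _ : Fin N => 2) → Prop := fun h => h.1 ∈ s
  have hp : Fintype.card {h // p h} = 2 * s.card := by
    rw [Fintype.card_congr (show {h // p h} ≃ s × Fin 2 from ⟨fun h => (⟨h.1.1, h.2⟩, h.1.2),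
      fun q => ⟨⟨q.1.1, q.2⟩, q.1.2⟩, fun _ => rfl, fun _ => rfl⟩)]
    simp [mul_comm]
  have hnp : Fintype.card {h // ¬ p h} = 2 * (N - s.card) := by
    rw [Fintype.card_subtype_compl, hp]
    simp
    lia
  have hsplit : Finset.card {π : Pairing (fun _ : Fin N => 2) | ∀ h, (π.1 h).1 ∈ s ↔ h.1 ∈ s}
      = Fintype.card (FreeInvolution {h // p h}) * Fintype.card (FreeInvolution {h // ¬ p h}) := by
    rw [← Fintype.card_prod, ← Fintype.card_subtype]
    exact Fintype.card_congr (freeInvolutionPreservingEquiv p)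
  have hfact : (N.choose s.card : ℝ) * s.card.factorial * (N - s.card).factorial
      = N.factorial := by exact_mod_cast Nat.choose_mul_factorial_mul_factorial hs
  have htwo : (2 : ℝ) ^ s.card * 2 ^ (N - s.card) = 2 ^ N := by
    rw [← pow_add, Nat.add_sub_cancel' hs]
  have := (returnProb_pos N).ne'
  rw [hsplit, card_pairing, Nat.cast_mul, card_freeInvolution _ hp, card_freeInvolution _ hnp,
    splitCoeff, ← hfact, ← htwo]
  field_simp

open scoped Classical in
lemma prod_component_eq_sum_finset {N : ℕ} (π : Pairing fun _ : Fin N => 2) (a b : ℝ) :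
    ∏ k : π.toMultigraph.Component, (a ^ k.size + b ^ k.size)
      = ∑ s : Finset (Fin N) with ∀ h, (π.1 h).1 ∈ s ↔ h.1 ∈ s, b ^ s.card * a ^ (N - s.card) := by
  have hmono := π.toMultigraph.sum_mono_prod_eq_prod_component fun q : Prop => if q then b else a
  simp only [Fintype.univ_Prop, Finset.sum_pair true_ne_false, if_true, if_false,
    π.isMono_toMultigraph] at hmono
  simp only [add_comm (a ^ _), ← hmono, Finset.sum_filter, eq_iff_iff]
  let toProp : Finset (Fin N) ≃ (Fin N → Prop) := Fintype.finsetEquivSet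
  refine (Fintype.sum_equiv toProp _ _ fun s => ?_).symm
  refine if_congr (by rfl) ?_ rfl
  have hprod : ∏ v, (if v ∈ s then b else a) = b ^ s.card * a ^ (N - s.card) := by
    simp [Finset.prod_ite, Finset.filter_not, Finset.card_univ_sdiff]
  exact hprod.symm.trans (Finset.prod_congr rfl fun v _ => if_congr (by rfl) rfl rfl)

open scoped Classical in
lemma sum_pairing_prod_component (N : ℕ) (a b : ℝ) :
    ∑ π : Pairing (fun _ : Fin N => 2),
        ∏ k : π.toMultigraph.Component, (a ^ k.size + b ^ k.size)
      = Fintype.card (Pairing fun _ : Fin N => 2) *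
        ∑ k ∈ Finset.range (N + 1), splitCoeff N k * (b ^ k * a ^ (N - k)) := by
  have hset (s : Finset (Fin N)) :
      ∑ π : Pairing (fun _ : Fin N => 2) with ∀ h, (π.1 h).1 ∈ s ↔ h.1 ∈ s,
          b ^ s.card * a ^ (N - s.card)
        = (Fintype.card (Pairing fun _ : Fin N => 2) * splitCoeff N s.card / N.choose s.card)
          * (b ^ s.card * a ^ (N - s.card)) := by
    have hs : s.card ≤ N := (Finset.card_le_univ s).trans_eq (Fintype.card_fin N)
    rw [Finset.sum_const, nsmul_eq_mul, ← card_pairing_preserving,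
      mul_div_cancel_right₀ _ (Nat.cast_ne_zero.2 (Nat.choose_pos hs).ne')]
  simp only [prod_component_eq_sum_finset, Finset.sum_filter] at hset ⊢
  rw [Finset.sum_comm, Finset.sum_congr rfl fun s _ => hset s, ← Finset.powerset_univ,
    Finset.sum_powerset_apply_card (f := fun k =>
      Fintype.card (Pairing fun _ : Fin N => 2) * splitCoeff N k / N.choose k
        * (b ^ k * a ^ (N - k))), Finset.card_univ, Fintype.card_fin, Finset.mul_sum]
  refine Finset.sum_congr rfl fun k hk => ?_
  have := (Nat.choose_pos (Finset.mem_range_succ_iff.1 hk)).ne'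
  rw [nsmul_eq_mul]
  field_simp

open scoped Classical in
lemma integral_prod_component (N : ℕ) (a b : ℝ) :
    ∫ G, ∏ k : G.Component, (a ^ k.size + b ^ k.size) ∂twoRegularCM N
      = ∑ k ∈ Finset.range (N + 1), splitCoeff N k * (b ^ k * a ^ (N - k)) := by
  rw [integral_twoRegularCM, sum_pairing_prod_component,
    inv_mul_cancel_left₀ (Nat.cast_ne_zero.2 Fintype.card_ne_zero)]

/-- The mean of `∏ (1 + r ^ L)` over the component sizes `L` of the 2-regular configuration
model. -/
def cyclePolynomial (N : ℕ) (r : ℝ) : ℝ := ∑ k ∈ Finset.range (N + 1), splitCoeff N k * r ^ k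

theorem integral_partitionFunction (N : ℕ) (β b : ℝ) :
    ∫ G, partitionFunction G β b ∂twoRegularCM N
      = upperEigenvalue β b ^ N * cyclePolynomial N (eigenRatio β b) := by
  have hprod : ∫ G, partitionFunction G β b ∂twoRegularCM N
      = ∫ G, ∏ k : G.Component, (upperEigenvalue β b ^ k.size + lowerEigenvalue β b ^ k.size)
          ∂twoRegularCM N := by
    simp only [integral_twoRegularCM,
      partitionFunction_eq_prod_component (Pairing.isTwoRegular_toMultigraph _)]
  rw [hprod, integral_prod_component, cyclePolynomial, Finset.mul_sum]
  refine Finset.sum_congr rfl fun k hk => ?_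
  have hpow : upperEigenvalue β b ^ N
      = upperEigenvalue β b ^ k * upperEigenvalue β b ^ (N - k) := by
    rw [← pow_add, Nat.add_sub_cancel' (Finset.mem_range_succ_iff.1 hk)]
  have := (upperEigenvalue_pos β b).ne'
  rw [hpow, eigenRatio, div_pow]
  field_simp

lemma integral_two_pow_card_component (N : ℕ) :
    ∫ G, (2 : ℝ) ^ Fintype.card G.Component ∂twoRegularCM N = cyclePolynomial N 1 := by
  have := integral_prod_component N 1 1
  simpa only [one_pow, one_add_one_eq_two, Finset.prod_const, Finset.card_univ, mul_one,
    cyclePolynomial] using this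

/-! ### Asymptotics of the cycle polynomial -/

lemma returnProb_zero : returnProb 0 = 1 := by simp [returnProb]

lemma returnProb_succ (n : ℕ) :
    returnProb (n + 1) = returnProb n * ((2 * n + 1) / (2 * n + 2)) := by
  have hsucc : ((n : ℝ) + 1) * (n + 1).centralBinom = 2 * (2 * n + 1) * n.centralBinom := by
    exact_mod_cast n.succ_mul_centralBinom_succ
  rw [returnProb, returnProb, pow_succ]
  field_simp
  linear_combination 2 * hsucc

lemma returnProb_mul_le (k m : ℕ) : returnProb k * returnProb m ≤ returnProb (k + m) := by
  induction k with
  | zero => simp [returnProb_zero]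
  | succ k ih =>
    rw [Nat.succ_add, returnProb_succ, returnProb_succ, mul_right_comm]
    refine mul_le_mul ih ?_ (by positivity) (returnProb_pos _).le
    push_cast
    rw [div_le_div_iff₀ (by positivity) (by positivity)]
    nlinarith [Nat.cast_nonneg (α := ℝ) k, Nat.cast_nonneg (α := ℝ) m]

lemma returnProb_succ_le (n : ℕ) : returnProb (n + 1) ≤ returnProb n := by
  rw [returnProb_succ]
  refine mul_le_of_le_one_right (returnProb_pos n).le ?_
  rw [div_le_one (by positivity)]
  linarith

lemma returnProb_le_one (n : ℕ) : returnProb n ≤ 1 :=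
  returnProb_zero ▸ antitone_nat_of_succ_le returnProb_succ_le (Nat.zero_le n)

lemma splitCoeff_nonneg (N k : ℕ) : 0 ≤ splitCoeff N k :=
  div_nonneg (mul_nonneg (returnProb_pos _).le (returnProb_pos _).le) (returnProb_pos _).le

lemma splitCoeff_le_one {N k : ℕ} (hk : k ≤ N) : splitCoeff N k ≤ 1 := by
  rw [splitCoeff, div_le_one (returnProb_pos _)]
  simpa only [Nat.add_sub_cancel' hk] using returnProb_mul_le k (N - k)

lemma tendsto_returnProb_div (k : ℕ) :
    Tendsto (fun n => returnProb n / returnProb (n + k)) atTop (𝓝 1) := by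
  induction k with
  | zero => simp [div_self (returnProb_pos _).ne']
  | succ k ih =>
    have hstep : Tendsto (fun n => returnProb n / returnProb (n + 1)) atTop (𝓝 1) := by
      have hratio (n : ℕ) : returnProb n / returnProb (n + 1)
          = 1 + 1 / (((2 * n : ℕ) : ℝ) + 1) := by
        have := (returnProb_pos n).ne'
        rw [returnProb_succ]
        push_cast
        field_simp
        ring
      simpa [hratio] using ((tendsto_one_div_add_atTop_nhds_zero_nat (𝕜 := ℝ)).comp
        (tendsto_id.const_mul_atTop' two_pos)).const_add 1
    have hmul := ih.mul (hstep.comp (tendsto_add_atTop_nat k))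
    rw [mul_one] at hmul
    refine hmul.congr fun n => ?_
    exact div_mul_div_cancel₀ (returnProb_pos _).ne'

lemma tendsto_splitCoeff (k : ℕ) :
    Tendsto (fun N => splitCoeff N k) atTop (𝓝 (returnProb k)) := by
  rw [← tendsto_add_atTop_iff_nat k]
  have hmul := (tendsto_returnProb_div k).const_mul (returnProb k)
  rw [mul_one] at hmul
  refine hmul.congr fun n => ?_
  rw [splitCoeff, Nat.add_sub_cancel, mul_div_assoc]

lemma tendsto_cyclePolynomial {r : ℕ → ℝ} {r₀ : ℝ} (hr : Tendsto r atTop (𝓝 r₀))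
    (hr₀ : |r₀| < 1) :
    Tendsto (fun N => cyclePolynomial N (r N)) atTop (𝓝 (∑' k, returnProb k * r₀ ^ k)) := by
  obtain ⟨ρ, hρ, hρ_one⟩ := exists_between hr₀
  have hρ_nonneg : 0 ≤ ρ := (abs_nonneg _).trans hρ.le
  have htsum (N : ℕ) : cyclePolynomial N (r N)
      = ∑' k, if k ∈ Finset.range (N + 1) then splitCoeff N k * r N ^ k else 0 := by
    rw [cyclePolynomial, tsum_eq_sum (s := Finset.range (N + 1)) fun k hk => if_neg hk]
    exact Finset.sum_congr rfl fun k hk => (if_pos hk).symm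
  simp only [htsum]
  refine tendsto_tsum_of_dominated_convergence (bound := fun k => ρ ^ k)
    (summable_geometric_of_lt_one hρ_nonneg hρ_one) (fun k => ?_) ?_
  · refine ((tendsto_splitCoeff k).mul (hr.pow k)).congr' ?_
    filter_upwards [eventually_ge_atTop k] with N hN
    rw [if_pos (Finset.mem_range_succ_iff.2 hN)]
  · filter_upwards [hr.abs.eventually_lt_const hρ] with N hN k
    split_ifs with hk
    · rw [norm_mul, norm_pow, Real.norm_of_nonneg (splitCoeff_nonneg _ _), Real.norm_eq_abs]
      exact (mul_le_of_le_one_left (by positivity)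
        (splitCoeff_le_one (Finset.mem_range_succ_iff.1 hk))).trans
        (pow_le_pow_left₀ (abs_nonneg _) hN.le k)
    · rw [norm_zero]
      positivity

lemma tsum_returnProb_mul_pow_pos {r : ℝ} (hr : |r| < 1) : 0 < ∑' k, returnProb k * r ^ k := by
  have hsummable : Summable fun k => returnProb k * r ^ k := by
    refine Summable.of_norm_bounded (summable_geometric_of_lt_one (abs_nonneg r) hr) fun k => ?_
    rw [norm_mul, norm_pow, Real.norm_of_nonneg (returnProb_pos k).le, Real.norm_eq_abs]
    exact mul_le_of_le_one_left (by positivity) (returnProb_le_one k)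
  have heven : Summable fun k => returnProb (2 * k) * r ^ (2 * k) :=
    hsummable.comp_injective (i := fun k => 2 * k) fun _ _ h => by simpa using h
  have hodd : Summable fun k => returnProb (2 * k + 1) * r ^ (2 * k + 1) :=
    hsummable.comp_injective (i := fun k => 2 * k + 1) fun _ _ h => by simpa using h
  have hpair (k : ℕ) : returnProb (2 * k) * r ^ (2 * k)
      + returnProb (2 * k + 1) * r ^ (2 * k + 1)
      = (returnProb (2 * k) + returnProb (2 * k + 1) * r) * (r ^ k) ^ 2 := by ring
  have hcoeff (k : ℕ) : 0 < returnProb (2 * k) + returnProb (2 * k + 1) * r := by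
    nlinarith [returnProb_succ_le (2 * k), returnProb_pos (2 * k), returnProb_pos (2 * k + 1),
      (abs_lt.1 hr).1]
  rw [← tsum_even_add_odd (f := fun k => returnProb k * r ^ k) heven hodd,
    ← heven.tsum_add hodd]
  simp only [hpair]
  refine Summable.tsum_pos (by simpa only [hpair] using heven.add hodd)
    (fun k => mul_nonneg (hcoeff k).le (sq_nonneg _)) 0 (mul_pos (hcoeff 0) (by simp))

lemma cyclePolynomial_one_le (N : ℕ) : cyclePolynomial N 1 ≤ N + 1 := by
  refine (Finset.sum_le_card_nsmul _ _ 1 fun k hk => ?_).trans (by simp)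
  rw [one_pow, mul_one]
  exact splitCoeff_le_one (Finset.mem_range_succ_iff.1 hk)

/-! ### Almost sure convergence of the susceptibility -/

lemma ae_isTwoRegular_twoRegularCM (N : ℕ) : ∀ᵐ G ∂twoRegularCM N, G.IsTwoRegular :=
  (ae_map_iff measurable_from_top.aemeasurable (MeasurableSpace.measurableSet_top)).2
    (ae_of_all _ Pairing.isTwoRegular_toMultigraph)

lemma twoRegularCM_real_two_pow_card_component_ge_le (N : ℕ) :
    (twoRegularCM N).real {G | ((N : ℝ) + 1) ^ 3 ≤ 2 ^ Fintype.card G.Component}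
      ≤ 1 / ((N : ℝ) + 1) ^ 2 := by
  have hmarkov := mul_meas_ge_le_integral_of_nonneg (μ := twoRegularCM N)
    (f := fun G => (2 : ℝ) ^ Fintype.card G.Component) (ae_of_all _ fun G => by positivity)
    (integrable_twoRegularCM _) (((N : ℝ) + 1) ^ 3)
  rw [integral_two_pow_card_component] at hmarkov
  rw [le_div_iff₀ (by positivity)]
  refine le_of_mul_le_mul_right ?_ (by positivity : 0 < (N : ℝ) + 1)
  linarith [hmarkov.trans (cyclePolynomial_one_le N)]

section

variable {Ω : Type*} [MeasurableSpace Ω] {P : Measure Ω} {G : (N : ℕ) → Ω → Multigraph (Fin N)}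

lemma ae_eventually_two_pow_card_component_lt
    (hG : ∀ N, 1 ≤ N → HasLaw (G N) (twoRegularCM N) P) :
    ∀ᵐ ω ∂P, ∀ᶠ N : ℕ in atTop,
      (2 : ℝ) ^ Fintype.card (G N ω).Component < ((N : ℝ) + 1) ^ 3 := by
  let large (N : ℕ) : Set (Multigraph (Fin N)) :=
    {G | ((N : ℝ) + 1) ^ 3 ≤ 2 ^ Fintype.card G.Component}
  have hle (N : ℕ) : P (G (N + 1) ⁻¹' large (N + 1))
      ≤ ENNReal.ofReal (1 / (((N + 1 : ℕ) : ℝ) + 1) ^ 2) := by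
    have hlaw := (hG (N + 1) N.succ_pos).measure_eq (p := (· ∈ large (N + 1))) trivial
    refine hlaw.trans_le ?_
    rw [← ofReal_measureReal]
    exact ENNReal.ofReal_le_ofReal (twoRegularCM_real_two_pow_card_component_ge_le _)
  have hsummable : Summable fun N : ℕ => 1 / (((N + 1 : ℕ) : ℝ) + 1) ^ 2 := by
    have := (summable_nat_add_iff 2).2 (Real.summable_one_div_nat_pow.2 one_lt_two)
    refine this.congr fun N => ?_
    push_cast
    ring
  have hsum : ∑' N, P (G (N + 1) ⁻¹' large (N + 1)) ≠ ∞ :=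
    ne_top_of_le_ne_top hsummable.tsum_ofReal_ne_top (ENNReal.tsum_le_tsum hle)
  filter_upwards [ae_eventually_notMem hsum] with ω hω
  rw [← map_add_atTop_eq_nat 1, eventually_map]
  exact hω.mono fun N hN => not_le.1 hN

lemma ae_tendsto_card_component_div (hG : ∀ N, 1 ≤ N → HasLaw (G N) (twoRegularCM N) P) :
    ∀ᵐ ω ∂P, Tendsto (fun N : ℕ => (Fintype.card (G N ω).Component : ℝ) / N) atTop (𝓝 0) := by
  filter_upwards [ae_eventually_two_pow_card_component_lt hG] with ω hω
  have hlog : Tendsto (fun N : ℕ => 3 / Real.log 2 * (Real.log ((N : ℝ) + 1) / N)) atTop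
      (𝓝 0) := by
    simpa using ((Real.tendsto_pow_log_div_mul_add_atTop 1 (-1) 1 one_ne_zero).comp
      (tendsto_natCast_atTop_atTop.atTop_add (tendsto_const_nhds (x := (1 : ℝ))))).const_mul
        (3 / Real.log 2)
  refine squeeze_zero' (.of_forall fun N => by positivity) ?_ hlog
  filter_upwards [hω] with N hN
  have hlt := Real.log_lt_log (by positivity) hN
  rw [Real.log_pow, Real.log_pow, ← lt_div_iff₀ (Real.log_pos one_lt_two)] at hlt
  rw [← mul_div_assoc, div_mul_eq_mul_div]
  exact div_le_div_of_nonneg_right hlt.le N.cast_nonneg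

theorem ae_tendsto_susceptibility (hG : ∀ N, 1 ≤ N → HasLaw (G N) (twoRegularCM N) P) (β b : ℝ) :
    ∀ᵐ ω ∂P, Tendsto (fun N : ℕ => susceptibility (G N ω) β b) atTop
      (𝓝 (lineSusceptibility β b)) := by
  have hregular : ∀ᵐ ω ∂P, ∀ N, 1 ≤ N → (G N ω).IsTwoRegular := by
    refine ae_all_iff.2 fun N => ?_
    by_cases hN : 1 ≤ N
    · filter_upwards [((hG N hN).ae_iff measurable_from_top).2 (ae_isTwoRegular_twoRegularCM N)]
        with ω hω _ using hω
    · exact ae_of_all _ fun _ h => absurd h hN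
  filter_upwards [hregular, ae_tendsto_card_component_div hG] with ω hω hcard
  exact tendsto_susceptibility ((eventually_ge_atTop 1).mono hω) hcard β b

end

/-! ### The annealed central limit theorem -/

instance : MeasurableSingletonClass ℤˣ :=
  ⟨fun u => ⟨{(u : ℤ)}, measurableSet_singleton _, by ext v; simp [Units.ext_iff]⟩⟩

lemma annealedProb_nonneg {N : ℕ} (Q : Measure (Multigraph (Fin N))) (β b : ℝ)
    (σ : SpinConfig N) : 0 ≤ annealedProb Q β b σ :=
  div_nonneg (integral_nonneg fun G => (boltzmannWeight_pos G β b σ).le)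
    (integral_nonneg fun G => (partitionFunction_pos G β b).le)

lemma integral_annealedMeasure {N : ℕ} {E : Type*} [NormedAddCommGroup E] [NormedSpace ℝ E]
    [CompleteSpace E] (Q : Measure (Multigraph (Fin N))) (β b : ℝ) (f : SpinConfig N → E) :
    ∫ σ, f σ ∂annealedMeasure Q β b = ∑ σ, annealedProb Q β b σ • f σ := by
  rw [annealedMeasure, integral_finsetSum_measure fun _ _ =>
    Integrable.of_finite.smul_measure ENNReal.ofReal_ne_top]
  refine Finset.sum_congr rfl fun σ _ => ?_
  rw [integral_smul_measure, integral_dirac, ENNReal.toReal_ofReal (annealedProb_nonneg Q β b σ)]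

lemma boltzmannWeight_mul_exp_totalSpin {N : ℕ} (G : Multigraph (Fin N)) (β b u : ℝ)
    (σ : SpinConfig N) :
    boltzmannWeight G β b σ * Real.exp (u * totalSpin σ) = boltzmannWeight G β (b + u) σ := by
  rw [boltzmannWeight, boltzmannWeight, ← Real.exp_add]
  ring_nf

lemma mgf_totalSpin_annealedMeasure {N : ℕ} {Q : Measure (Multigraph (Fin N))} {β b u : ℝ}
    (hQ : ∀ σ, Integrable (fun G => boltzmannWeight G β (b + u) σ) Q) :
    mgf totalSpin (annealedMeasure Q β b) u
      = (∫ G, partitionFunction G β (b + u) ∂Q) / ∫ G, partitionFunction G β b ∂Q := by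
  have hsum : ∫ G, partitionFunction G β (b + u) ∂Q
      = ∑ σ, ∫ G, boltzmannWeight G β (b + u) σ ∂Q := integral_finsetSum _ fun σ _ => hQ σ
  rw [mgf, integral_annealedMeasure, hsum, Finset.sum_div]
  refine Finset.sum_congr rfl fun σ _ => ?_
  rw [annealedProb, smul_eq_mul, div_mul_eq_mul_div, ← integral_mul_const]
  simp only [boltzmannWeight_mul_exp_totalSpin]

lemma integral_partitionFunction_pos (N : ℕ) (β b : ℝ) :
    0 < ∫ G, partitionFunction G β b ∂twoRegularCM N := by
  have hsupport : Function.support (fun G : Multigraph (Fin N) => partitionFunction G β b)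
      = Set.univ := Set.eq_univ_of_forall fun G => (partitionFunction_pos G β b).ne'
  rw [integral_pos_iff_support_of_nonneg (fun G => (partitionFunction_pos G β b).le)
    (integrable_twoRegularCM _), hsupport]
  simp

lemma cyclePolynomial_eigenRatio_pos (N : ℕ) (β b : ℝ) :
    0 < cyclePolynomial N (eigenRatio β b) :=
  pos_of_mul_pos_right (integral_partitionFunction N β b ▸ integral_partitionFunction_pos N β b)
    (pow_pos (upperEigenvalue_pos β b) N).le

lemma cgf_totalSpin_annealedMeasure (N : ℕ) (β b u : ℝ) :
    cgf totalSpin (annealedMeasure (twoRegularCM N) β b) u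
      = N * (Real.log (upperEigenvalue β (b + u)) - Real.log (upperEigenvalue β b)) +
        (Real.log (cyclePolynomial N (eigenRatio β (b + u))) -
          Real.log (cyclePolynomial N (eigenRatio β b))) := by
  have hlog (c : ℝ) : Real.log (∫ G, partitionFunction G β c ∂twoRegularCM N)
      = N * Real.log (upperEigenvalue β c) + Real.log (cyclePolynomial N (eigenRatio β c)) := by
    rw [integral_partitionFunction, Real.log_mul (pow_pos (upperEigenvalue_pos β c) N).ne'
      (cyclePolynomial_eigenRatio_pos N β c).ne', Real.log_pow]
  rw [cgf, mgf_totalSpin_annealedMeasure fun _ => integrable_twoRegularCM _,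
    Real.log_div (integral_partitionFunction_pos _ _ _).ne'
      (integral_partitionFunction_pos _ _ _).ne', hlog, hlog]
  ring

lemma cgf_sub_div {Ω : Type*} [MeasurableSpace Ω] {P : Measure Ω} [NeZero P] {X : Ω → ℝ} {t s : ℝ}
    (hX : Integrable (fun ω => Real.exp (t / s * X ω)) P) (c : ℝ) :
    cgf (fun ω => (X ω - c) / s) P t = cgf X P (t / s) - t / s * c := by
  have hmgf : mgf (fun ω => (X ω - c) / s) P t = mgf X P (t / s) * Real.exp (-(t / s * c)) := by
    simp only [mgf, ← integral_mul_const, ← Real.exp_add]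
    refine integral_congr_ae (.of_forall fun ω => congrArg Real.exp ?_)
    ring
  rw [cgf, hmgf, Real.log_mul (mgf_pos' (NeZero.ne P) hX).ne' (Real.exp_pos _).ne', Real.log_exp]
  rfl

lemma tendsto_sub_sub_mul_div_sq {f f' : ℝ → ℝ} {a c : ℝ}
    (hf : ∀ᶠ x in 𝓝 a, HasDerivAt f (f' x) x) (hf' : HasDerivAt f' c a) :
    Tendsto (fun x => (f x - f a - f' a * (x - a)) / (x - a) ^ 2) (𝓝[≠] a) (𝓝 (c / 2)) := by
  have hcont : Tendsto f (𝓝[≠] a) (𝓝 (f a)) := hf.self_of_nhds.continuousAt.continuousWithinAt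
  have hid : Tendsto (fun x : ℝ => x - a) (𝓝[≠] a) (𝓝 0) := by
    simpa using (tendsto_id.mono_left (nhdsWithin_le_nhds (a := a))).sub_const a
  refine HasDerivAt.lhopital_zero_nhdsNE (f' := fun x => f' x - f' a)
    (g' := fun x => 2 * (x - a)) ?_ ?_ ?_ ?_ ?_ ?_
  · filter_upwards [nhdsWithin_le_nhds hf] with x hx
    simpa only [mul_one] using
      (hx.sub_const (f a)).fun_sub (((hasDerivAt_id' x).sub_const a).const_mul (f' a))
  · filter_upwards with x
    simpa using ((hasDerivAt_id' x).sub_const a).fun_pow 2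
  · filter_upwards [self_mem_nhdsWithin] with x hx
    exact mul_ne_zero two_ne_zero (sub_ne_zero.2 hx)
  · simpa using (hcont.sub_const (f a)).sub (hid.const_mul (f' a))
  · simpa using hid.pow 2
  · refine ((hasDerivAt_iff_tendsto_slope.1 hf').div_const 2).congr fun x => ?_
    rw [slope_def_field, div_div, mul_comm]

lemma tendsto_div_sqrt_natCast (t : ℝ) : Tendsto (fun N : ℕ => t / √(N : ℝ)) atTop (𝓝 0) :=
  (Real.tendsto_sqrt_atTop.comp tendsto_natCast_atTop_atTop).const_div_atTop t

lemma tendsto_mul_sub_sub_mul_div_sqrt {f f' : ℝ → ℝ} {a c : ℝ}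
    (hf : ∀ᶠ x in 𝓝 a, HasDerivAt f (f' x) x) (hf' : HasDerivAt f' c a) (t : ℝ) :
    Tendsto (fun N : ℕ => (N : ℝ) * (f (a + t / √(N : ℝ)) - f a - f' a * (t / √(N : ℝ)))) atTop
      (𝓝 (c * t ^ 2 / 2)) := by
  rcases eq_or_ne t 0 with rfl | ht
  · simp
  have hx : Tendsto (fun N : ℕ => a + t / √(N : ℝ)) atTop (𝓝[≠] a) := by
    refine tendsto_nhdsWithin_iff.2 ⟨by simpa using (tendsto_div_sqrt_natCast t).const_add a, ?_⟩
    filter_upwards [eventually_gt_atTop 0] with N hN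
    have : 0 < √(N : ℝ) := Real.sqrt_pos.2 (Nat.cast_pos.2 hN)
    simp [ht, this.ne']
  rw [mul_div_right_comm]
  refine (((tendsto_sub_sub_mul_div_sq hf hf').comp hx).mul_const (t ^ 2)).congr' ?_
  filter_upwards [eventually_gt_atTop 0] with N hN
  have hN' : (N : ℝ) ≠ 0 := Nat.cast_ne_zero.2 hN.ne'
  simp only [Function.comp, add_sub_cancel_left, div_pow, Real.sq_sqrt N.cast_nonneg]
  field_simp

lemma tendsto_log_cyclePolynomial_eigenRatio (β : ℝ) {b : ℝ} {x : ℕ → ℝ}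
    (hx : Tendsto x atTop (𝓝 b)) :
    Tendsto (fun N => Real.log (cyclePolynomial N (eigenRatio β (x N)))) atTop
      (𝓝 (Real.log (∑' k, returnProb k * eigenRatio β b ^ k))) :=
  (tendsto_cyclePolynomial ((hasDerivAt_eigenRatio β b).continuousAt.tendsto.comp hx)
    (abs_eigenRatio_lt_one β b)).log (tsum_returnProb_mul_pow_pos (abs_eigenRatio_lt_one β b)).ne'

lemma hasDerivAt_log_upperEigenvalue (β b : ℝ) :
    HasDerivAt (fun c => Real.log (upperEigenvalue β c)) (lineMagnetization β b) b :=
  ((hasDerivAt_upperEigenvalue β b).log (upperEigenvalue_pos β b).ne').congr_deriv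
    (mul_div_cancel_right₀ _ (upperEigenvalue_pos β b).ne')

lemma tendsto_cgf_totalSpin_annealedMeasure (β b t : ℝ) :
    Tendsto (fun N : ℕ => cgf (fun σ => (totalSpin σ - N * lineMagnetization β b) / √(N : ℝ))
        (annealedMeasure (twoRegularCM N) β b) t) atTop
      (𝓝 (lineSusceptibility β b * t ^ 2 / 2)) := by
  have hmain := tendsto_mul_sub_sub_mul_div_sqrt
    (.of_forall (hasDerivAt_log_upperEigenvalue β)) (hasDerivAt_lineMagnetization β b) t
  have hshift : Tendsto (fun N : ℕ => b + t / √(N : ℝ)) atTop (𝓝 b) := by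
    simpa using (tendsto_div_sqrt_natCast t).const_add b
  have hcorrection := (tendsto_log_cyclePolynomial_eigenRatio β hshift).sub
    (tendsto_log_cyclePolynomial_eigenRatio β (tendsto_const_nhds (x := b)))
  rw [sub_self] at hcorrection
  refine ((hmain.add hcorrection).congr fun N => ?_).trans_eq (by rw [add_zero])
  rw [cgf_sub_div .of_finite, cgf_totalSpin_annealedMeasure]
  ring

theorem tendstoInDistribution_totalSpin (β b : ℝ) {χ : ℝ≥0}
    (hχ : (χ : ℝ) = lineSusceptibility β b) :
    TendstoInDistribution
      (fun (N : ℕ) (σ : SpinConfig N) =>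
        (totalSpin σ - ∫ τ, totalSpin τ ∂(annealedMeasure (twoRegularCM N) β b)) / √(N : ℝ))
      atTop (id : ℝ → ℝ)
      (fun N => annealedMeasure (twoRegularCM N) β b) (gaussianReal 0 χ) := by
  have h := tendstoInDistribution_sub_integral_of_tendsto_cgf (v := χ)
    (X := fun (N : ℕ) (σ : SpinConfig N) => (totalSpin σ - N * lineMagnetization β b) / √(N : ℝ))
    (fun _ => .of_finite) (fun _ _ => .of_finite)
    (hχ ▸ tendsto_cgf_totalSpin_annealedMeasure β b)
  convert h using 3 with N σ
  rw [integral_div, integral_sub .of_finite .of_finite, integral_const, probReal_univ, one_smul]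
  ring

end

theorem mainTheorem4_general {Ω : Type*} [MeasurableSpace Ω] (P : Measure Ω)
    (G : (N : ℕ) → Ω → Multigraph (Fin N))
    (hG : ∀ N, 1 ≤ N → HasLaw (G N) (twoRegularCM N) P) (β B : ℝ) :
    ∃ χ : ℝ≥0,
      TendstoInDistribution
        (fun (N : ℕ) (σ : SpinConfig N) =>
          (totalSpin σ - ∫ τ, totalSpin τ ∂(annealedMeasure (twoRegularCM N) β B)) / √(N : ℝ))
        atTop (id : ℝ → ℝ)
        (fun N => annealedMeasure (twoRegularCM N) β B) (gaussianReal 0 χ) ∧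
      (∀ᵐ ω ∂P, Tendsto (fun N : ℕ => susceptibility (G N ω) β B) atTop (𝓝 (χ : ℝ))) ∧
      Tendsto (fun N : ℕ => susceptibility (cycle N) β B) atTop (𝓝 (χ : ℝ)) ∧
      (χ : ℝ) = Real.cosh B * Real.exp (-4 * β) /
        (Real.sinh B ^ 2 + Real.exp (-4 * β)) ^ (3 / 2 : ℝ) :=
  ⟨⟨lineSusceptibility β B, (lineSusceptibility_pos β B).le⟩,
    tendstoInDistribution_totalSpin β B rfl, ae_tendsto_susceptibility hG β B,
    tendsto_susceptibility_cycle β B, lineSusceptibility_eq β B⟩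

theorem mainTheorem4 {Ω : Type*} [MeasurableSpace Ω] (P : Measure Ω) [IsProbabilityMeasure P]
    (G : (N : ℕ) → Ω → Multigraph (Fin N))
    (hG : ∀ N, 1 ≤ N → HasLaw (G N) (twoRegularCM N) P)
    (β B : ℝ) (hβ : 0 ≤ β) :
    ∃ χ : ℝ≥0,
      TendstoInDistribution
        (fun (N : ℕ) (σ : SpinConfig N) =>
          (totalSpin σ - ∫ τ, totalSpin τ ∂(annealedMeasure (twoRegularCM N) β B)) / √(N : ℝ))
        atTop (id : ℝ → ℝ)
        (fun N => annealedMeasure (twoRegularCM N) β B) (gaussianReal 0 χ) ∧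
      (∀ᵐ ω ∂P, Tendsto (fun N : ℕ => susceptibility (G N ω) β B) atTop (𝓝 (χ : ℝ))) ∧
      Tendsto (fun N : ℕ => susceptibility (cycle N) β B) atTop (𝓝 (χ : ℝ)) ∧
      (χ : ℝ) = Real.cosh B * Real.exp (-4 * β) /
        (Real.sinh B ^ 2 + Real.exp (-4 * β)) ^ (3 / 2 : ℝ) :=
  mainTheorem4_general P G hG β B
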